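/- Let $\mathcal A$ and $\mathcal B$ be finite-dimensional (not necessarily associative) algebras over a field $\mathbb F$. Affine group schemes over $\mathbb F$ are regarded as group-valued functors $R\mapsto \mathbf G(R)$ on unital commutative associative $\mathbb F$-algebras, and $\mathbf{Aut}(\mathcal A)(R)=\mathrm{Aut}_{R\text{-alg}}(\mathcal A\otimes_{\mathbb F} R)$. For a grading $\Gamma:\mathcal A=\bigoplus_{g\in G}\mathcal A_g$ by an abelian group $G$ (so $\mathcal A_g\mathcal A_h\subseteq\mathcal A_{gh}$), with support $\mathrm{Supp}\,\Gamma=\{g\in G:\mathcal A_g\neq 0\}$, define subgroup schemes of $\mathbf{Aut}(\mathcal A)$ by: - $\mathbf{Stab}(\Gamma)(R)=\{\varphi:\varphi(\mathcal A_g\otimes R)=\mathcal A_g\otimes R\ \ \forall g\in G\}$; - $\mathbf{Diag}(\Gamma)(R)=\{\varphi:\forall g\in G,\ \varphi|_{\mathcal A_g\otimes R}\in R^\times\mathrm{id}\}$; - $\mathbf{Aut}(\Gamma)(R)$ is the set of $\varphi\in\mathbf{Aut}(\mathcal A)(R)$ for which there are nonzero orthogonal idempotents $e_1,\dots,e_n\in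 R$ with $e_1+\dots+e_n=1$ and permutations $\sigma_1,\dots,\sigma_n$ of $\mathrm{Supp}\,\Gamma$ with $\varphi(\mathcal A_g\otimes Re_i)=\mathcal A_{\sigma_i(g)}\otimes Re_i$ for all $i$ and all $g\in\mathrm{Supp}\,\Gamma$. Sending $\varphi$ to the locally constant function on $\mathrm{Spec}\,R$ given by the $\sigma_i$ defines a morphism from $\mathbf{Aut}(\Gamma)$ to the constant group scheme of $\mathrm{Sym}(\mathrm{Supp}\,\Gamma)$; its image (the smallest closed subgroup scheme through which it factors) is the Weyl group scheme $\mathsf W(\Gamma)$. The morphism $\eta_\Gamma:\mathbf D(G)\to\mathbf{Aut}(\mathcal A)$, where $\mathbf D(G)(R)=\mathrm{Hom}(G,R^\times)$, sends a character $\chi$ to the automorphism that multiplies $\mathcal A_g\otimes R$ by $\chi(g)$, for every $g\in G$. A $U$-grading $\Gamma$ is said to have universal group $U$ if $\eta_\Gamma$ maps $\mathbf D(U)$ isomorphically onto $\mathbf{Diag}(\Gamma)$. The grading $\Gamma$ is fine if there is no grading $\mathcal A=\bigoplus_{h\in H}\mathcal A'_h$ by an abelian group $H$ such that every nonzero $\mathcal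 A'_h$ is contained in some $\mathcal A_g$, at least one of these containments being strict. **Corollary.** Let $\phi:\mathbf{Aut}(\mathcal A)\to\mathbf{Aut}(\mathcal B)$ be an isomorphism of affine group schemes, and let $\Gamma$ be a fine grading on $\mathcal A$ with universal group $U$, regarded as a $U$-grading. Then there is a unique $U$-grading $\Gamma'$ on $\mathcal B$ with $\eta_{\Gamma'}=\phi\circ\eta_\Gamma$. This grading $\Gamma'$ is fine, and $\phi$ restricts to isomorphisms $\mathbf{Stab}(\Gamma)\simeq\mathbf{Stab}(\Gamma')$ and $\mathbf{Aut}(\Gamma)\simeq\mathbf{Aut}(\Gamma')$. Consequently $\phi$ induces an isomorphism $\mathsf W(\Gamma)\simeq\mathsf W(\Gamma')$, that is, one compatible with the isomorphism $\mathbf{Aut}(\Gamma)\simeq\mathbf{Aut}(\Gamma')$ and the canonical morphisms $\mathbf{Aut}(\Gamma)\to\mathsf W(\Gamma)$ and $\mathbf{Aut}(\Gamma')\to\mathsf W(\Gamma')$. -/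

import Mathlib

open CategoryTheory TensorProduct

universe u

namespace GradingScheme

noncomputable section

/-! ### Group functors on commutative algebras, subgroup functors, closedness, images -/

/-- Group-valued functors on the category of unital commutative associative `F`-algebras.
Affine group schemes over `F` are the representable ones; their morphisms are the natural
transformations. -/
abbrev GroupFunctor (F : Type u) [Field F] := CommAlgCat.{u} F ⥤ GrpCat.{u}

variable {F : Type u} [Field F]

/-- A subgroup functor: a subgroup of `G(R)` for every `R`, compatible with extension of scalars. -/
@[ext]
structure SubgroupFunctor (G : GroupFunctor F) where
  pts : ∀ R : CommAlgCat.{u} F, Subgroup (G.obj R)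
  map_mem : ∀ {R S : CommAlgCat.{u} F} (f : R ⟶ S) (g : G.obj R),
    g ∈ pts R → (G.map f).hom g ∈ pts S

namespace SubgroupFunctor

variable {G H : GroupFunctor F}

/-- A subgroup functor, seen as a group functor. -/
def toFunctor (K : SubgroupFunctor G) : GroupFunctor F where
  obj R := GrpCat.of (K.pts R)
  map {R S} f := GrpCat.ofHom
    (((G.map f).hom.comp (K.pts R).subtype).codRestrict (K.pts S)
      (fun g => K.map_mem f g.1 g.2))
  map_id R := by ext x; simp
  map_comp f g := by ext x; simp; rfl

/-- The inclusion of a subgroup functor. -/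
def incl (K : SubgroupFunctor G) : K.toFunctor ⟶ G where
  app R := GrpCat.ofHom (K.pts R).subtype
  naturality R S f := by ext x; rfl

/-- A subgroup functor `K` of `G` is closed if it is cut out by regular functions on `G`, i.e. by
morphisms from `G` to the affine line `R ↦ R`: a point of `G` at which every regular function
that vanishes on `K` vanishes lies in `K`. (If `G` is represented by `𝒪`, the regular functions are
the elements of `𝒪`, by Yoneda, and this says that `K` is represented by a quotient of `𝒪`.) -/
def IsClosed (K : SubgroupFunctor G) : Prop :=
  ∀ (R : CommAlgCat.{u} F) (g : G.obj R),
    (∀ a : (G ⋙ forget GrpCat.{u}) ⟶ forget (CommAlgCat.{u} F),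
      (∀ (S : CommAlgCat.{u} F) (k : G.obj S), k ∈ K.pts S → a.app S k = (0 : S)) →
        a.app R g = (0 : R)) →
    g ∈ K.pts R

/-- The image of a morphism of affine group schemes: the smallest closed subgroup scheme of
the target through which the morphism factors. -/
def image (f : G ⟶ H) : SubgroupFunctor H where
  pts R := sInf {P | ∃ K : SubgroupFunctor H, K.IsClosed ∧
    (∀ (S : CommAlgCat.{u} F) (g : G.obj S), (f.app S).hom g ∈ K.pts S) ∧ K.pts R = P}
  map_mem {R S} h x hx := by
    rw [Subgroup.mem_sInf] at hx ⊢
    rintro _ ⟨K, hK, hf, rfl⟩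
    exact K.map_mem h x (hx _ ⟨K, hK, hf, rfl⟩)

/-- The corestriction of a morphism to its image. -/
def toImage (f : G ⟶ H) : G ⟶ (image f).toFunctor where
  app R := GrpCat.ofHom ((f.app R).hom.codRestrict ((image f).pts R) (fun g => by
    refine Subgroup.mem_sInf.2 ?_
    rintro _ ⟨K, hK, hf, rfl⟩
    exact hf R g))
  naturality R S h := by
    ext x
    apply Subtype.ext
    exact ConcreteCategory.congr_hom (f.naturality h) x

end SubgroupFunctor

/-! ### General linear group schemes -/

section LinearGroups

variable {V : Type u} [AddCommGroup V] [Module F V]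

/-- The map `f ⊗ id : R ⊗ V → S ⊗ V`. -/
abbrev base (V : Type u) [AddCommGroup V] [Module F V] {R S : CommAlgCat.{u} F} (f : R ⟶ S) :
    (R ⊗[F] V) →ₗ[F] (S ⊗[F] V) :=
  f.hom.toLinearMap.rTensor V

lemma base_smul {R S : CommAlgCat.{u} F} (f : R ⟶ S) (r : R) (x : R ⊗[F] V) :
    base V f (r • x) = f.hom r • base V f x := by
  induction x with
  | zero => simp
  | tmul a v => simp [TensorProduct.smul_tmul']
  | add x y hx hy => simp only [smul_add, map_add, hx, hy]

/-- Extension of scalars of an `R`-linear endomorphism of `R ⊗ V` along `f : R → S`. -/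
def extendFun {R S : CommAlgCat.{u} F} (f : R ⟶ S) (l : Module.End R (R ⊗[F] V)) :
    Module.End S (S ⊗[F] V) :=
  LinearMap.liftBaseChange S
    (base V f ∘ₗ l.restrictScalars F ∘ₗ TensorProduct.mk F R V 1)

lemma extendFun_base {R S : CommAlgCat.{u} F} (f : R ⟶ S) (l : Module.End R (R ⊗[F] V))
    (x : R ⊗[F] V) : extendFun f l (base V f x) = base V f (l x) := by
  induction x with
  | zero => simp
  | tmul a v =>
    have h : a ⊗ₜ[F] v = a • ((1 : R) ⊗ₜ[F] v) := by simp [TensorProduct.smul_tmul']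
    rw [h, base_smul, map_smul, map_smul, base_smul]
    simp [extendFun]
  | add x y hx hy => simp only [map_add, hx, hy]

lemma end_ext {S : CommAlgCat.{u} F} {l m : Module.End S (S ⊗[F] V)}
    (h : ∀ v : V, l ((1 : S) ⊗ₜ v) = m ((1 : S) ⊗ₜ v)) : l = m := by
  apply TensorProduct.AlgebraTensorModule.curry_injective
  ext v
  exact h v

lemma base_one {R S : CommAlgCat.{u} F} (f : R ⟶ S) (v : V) :
    base V f ((1 : R) ⊗ₜ v) = (1 : S) ⊗ₜ v := by
  simp

/-- Extension of scalars as a homomorphism of monoids. -/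
def extend {R S : CommAlgCat.{u} F} (f : R ⟶ S) :
    Module.End R (R ⊗[F] V) →* Module.End S (S ⊗[F] V) where
  toFun := extendFun f
  map_one' := end_ext fun v => by
    rw [← base_one f, extendFun_base]; rfl
  map_mul' l m := end_ext fun v => by
    rw [← base_one f, extendFun_base, Module.End.mul_apply, Module.End.mul_apply,
      extendFun_base, extendFun_base]

lemma extend_base {R S : CommAlgCat.{u} F} (f : R ⟶ S) (l : Module.End R (R ⊗[F] V))
    (x : R ⊗[F] V) : extend f l (base V f x) = base V f (l x) :=
  extendFun_base f l x

variable (F V) in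
/-- The functor `R ↦ GL_R(R ⊗ V)`. -/
def glScheme : GroupFunctor F where
  obj R := GrpCat.of (LinearMap.GeneralLinearGroup R (R ⊗[F] V))
  map f := GrpCat.ofHom (Units.map (extend f))
  map_id R := by
    apply GrpCat.ext
    intro x
    apply Units.ext
    apply end_ext
    intro v
    change extend (𝟙 R) _ _ = _
    rw [← base_one (𝟙 R), extend_base]
    simp [base]
  map_comp {R S T} f g := by
    apply GrpCat.ext
    intro x
    apply Units.ext
    apply end_ext
    intro v
    change extend (f ≫ g) _ _ = extend g (extend f _) _
    have h (y : R ⊗[F] V) : base V (f ≫ g) y = base V g (base V f y) := by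
      simp [base, LinearMap.rTensor_comp]
    rw [← base_one (f ≫ g), extend_base, h, h, extend_base, extend_base]

/-- The endomorphism of `R ⊗ V` underlying an element of `GL(V)(R)`. -/
abbrev glEnd {R : CommAlgCat.{u} F} (φ : (glScheme F V).obj R) : Module.End R (R ⊗[F] V) :=
  Units.val (α := Module.End R (R ⊗[F] V)) φ

lemma glEnd_map {R S : CommAlgCat.{u} F} (f : R ⟶ S) (φ : (glScheme F V).obj R) :
    glEnd (((glScheme F V).map f).hom φ) = extend f (glEnd φ) := rfl

lemma glEnd_mul {R : CommAlgCat.{u} F} (φ ψ : (glScheme F V).obj R) :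
    glEnd (φ * ψ) = glEnd φ * glEnd ψ := rfl

lemma glEnd_one {R : CommAlgCat.{u} F} : glEnd (1 : (glScheme F V).obj R) = 1 := rfl

lemma glEnd_inv_apply {R : CommAlgCat.{u} F} (φ : (glScheme F V).obj R) (x : R ⊗[F] V) :
    glEnd φ⁻¹ (glEnd φ x) = x := by
  rw [← Module.End.mul_apply, ← glEnd_mul, inv_mul_cancel, glEnd_one, Module.End.one_apply]

lemma glEnd_apply_inv {R : CommAlgCat.{u} F} (φ : (glScheme F V).obj R) (x : R ⊗[F] V) :
    glEnd φ (glEnd φ⁻¹ x) = x := by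
  rw [← Module.End.mul_apply, ← glEnd_mul, mul_inv_cancel, glEnd_one, Module.End.one_apply]

/-- The `R`-submodule `Re ⊗ W` of `R ⊗ V`, for a subspace `W` of `V`. -/
def block (R : CommAlgCat.{u} F) (W : Submodule F V) (e : R) : Submodule R (R ⊗[F] V) :=
  (W.baseChange R).map (LinearMap.lsmul R (R ⊗[F] V) e)

lemma block_one (R : CommAlgCat.{u} F) (W : Submodule F V) : block R W 1 = W.baseChange R := by
  ext x; simp [block]

lemma block_mul (R : CommAlgCat.{u} F) (W : Submodule F V) (c e : R) :
    block R W (c * e) = (block R W e).map (LinearMap.lsmul R (R ⊗[F] V) c) := by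
  ext x; simp [block, mul_smul]

lemma block_map {R S : CommAlgCat.{u} F} (f : R ⟶ S) (W : Submodule F V) (e : R) :
    block S W (f.hom e) = Submodule.span S (base V f '' (block R W e : Set (R ⊗[F] V))) := by
  apply le_antisymm
  · rw [block, Submodule.baseChange_eq_span, Submodule.map_span, Submodule.span_le]
    rintro _ ⟨_, ⟨w, hw, rfl⟩, rfl⟩
    apply Submodule.subset_span
    refine ⟨e • ((1 : R) ⊗ₜ w), ⟨_, Submodule.tmul_mem_baseChange_of_mem _ hw, rfl⟩, ?_⟩
    rw [base_smul, base_one]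
    rfl
  · rw [Submodule.span_le]
    rintro _ ⟨_, ⟨x, hx, rfl⟩, rfl⟩
    refine ⟨base V f x, ?_, by simp [base_smul]⟩
    rw [SetLike.mem_coe, Submodule.baseChange_eq_span] at hx
    induction hx using Submodule.span_induction with
    | mem x h =>
      obtain ⟨w, hw, rfl⟩ := h
      rw [TensorProduct.mk_apply, base_one]
      exact Submodule.tmul_mem_baseChange_of_mem _ hw
    | zero => simp
    | add x y _ _ hx hy => rw [map_add]; exact add_mem hx hy
    | smul r x _ hx => rw [base_smul]; exact Submodule.smul_mem _ _ hx

lemma map_block_mul {R : CommAlgCat.{u} F} (l : Module.End R (R ⊗[F] V)) (W W' : Submodule F V)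
    (c e : R) (h : (block R W e).map l = block R W' e) :
    (block R W (c * e)).map l = block R W' (c * e) := by
  rw [block_mul, block_mul, ← h]
  ext x; simp

lemma map_block_extend {R S : CommAlgCat.{u} F} (f : R ⟶ S) (l : Module.End R (R ⊗[F] V))
    (W W' : Submodule F V) (e : R) (h : (block R W e).map l = block R W' e) :
    (block S W (f.hom e)).map (extend f l) = block S W' (f.hom e) := by
  rw [block_map, block_map, Submodule.map_span, ← h]
  congr 1
  ext x
  simp only [Set.mem_image, SetLike.mem_coe, Submodule.mem_map, exists_exists_and_eq_and,
    extend_base]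

/-- For a family `(V_s)` of subspaces of `V`: the endomorphism `l` of `R ⊗ V` permutes
the submodules `Re ⊗ V_s` according to `σ`. -/
def PermutesBy {ι : Type u} {R : CommAlgCat.{u} F} (W : ι → Submodule F V)
    (l : Module.End R (R ⊗[F] V)) (e : R) (σ : Equiv.Perm ι) : Prop :=
  ∀ s, (block R (W s) e).map l = block R (W (σ s)) e

/-- The defining condition of `GL(V, Γ)(R)`: there are nonzero orthogonal idempotents `e i` with
sum `1` and permutations `σ i` such that `l (V_s ⊗ Re_i) = V_{σ_i(s)} ⊗ Re_i`. -/
def PermutesLocally {ι : Type u} {R : CommAlgCat.{u} F} (W : ι → Submodule F V)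
    (l : Module.End R (R ⊗[F] V)) : Prop :=
  ∃ (n : ℕ) (e : Fin n → R) (σ : Fin n → Equiv.Perm ι),
    (∀ i, e i ≠ 0) ∧ CompleteOrthogonalIdempotents e ∧ ∀ i, PermutesBy W l (e i) (σ i)

lemma PermutesLocally.of_fintype {ι : Type u} {R : CommAlgCat.{u} F} {W : ι → Submodule F V}
    {l : Module.End R (R ⊗[F] V)} {κ : Type*} [Fintype κ] (e : κ → R) (σ : κ → Equiv.Perm ι)
    (he : CompleteOrthogonalIdempotents e) (h : ∀ i, PermutesBy W l (e i) (σ i)) :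
    PermutesLocally W l := by
  classical
  let κ' := {i : κ // e i ≠ 0}
  let q := Fintype.equivFin κ'
  refine ⟨Fintype.card κ', fun i => e (q.symm i).1, fun i => σ (q.symm i).1,
    fun i => (q.symm i).2, ?_, fun i => h _⟩
  refine ⟨⟨fun i => he.idem _, fun i j hij => he.ortho ?_⟩, ?_⟩
  · intro h'
    exact hij (q.symm.injective (Subtype.ext h'))
  · rw [q.symm.sum_comp (fun i : κ' => e i.1), ← he.complete]
    exact (Finset.sum_subtype (p := fun i => e i ≠ 0) (Finset.univ.filter fun i => e i ≠ 0)
      (by simp) e).symm.trans (Finset.sum_filter_ne_zero _)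

lemma PermutesLocally.one {ι : Type u} {R : CommAlgCat.{u} F} (W : ι → Submodule F V) :
    PermutesLocally (R := R) W 1 := by
  refine .of_fintype (κ := Unit) (fun _ => 1) (fun _ => 1) ?_ ?_
  · exact (CompleteOrthogonalIdempotents.unique_iff (e := fun _ : Unit => (1 : R))).2 rfl
  · intro _ s
    exact Submodule.map_id _

lemma PermutesLocally.mul {ι : Type u} {R : CommAlgCat.{u} F} {W : ι → Submodule F V}
    {l m : Module.End R (R ⊗[F] V)} (hl : PermutesLocally W l) (hm : PermutesLocally W m) :
    PermutesLocally W (l * m) := by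
  obtain ⟨n, e, σ, -, he, hσ⟩ := hl
  obtain ⟨n', e', σ', -, he', hσ'⟩ := hm
  refine .of_fintype (κ := Fin n × Fin n') (fun i => e i.1 * e' i.2)
    (fun i => σ i.1 * σ' i.2) ?_ ?_
  · refine ⟨⟨fun i => (he.idem i.1).mul (he'.idem i.2), ?_⟩, ?_⟩
    · rintro ⟨i, i'⟩ ⟨j, j'⟩ hij
      change e i * e' i' * (e j * e' j') = 0
      rw [mul_mul_mul_comm]
      by_cases h : i = j
      · have h' : i' ≠ j' := fun h' => hij (by rw [h, h'])
        rw [show e' i' * e' j' = 0 from he'.ortho h', mul_zero]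
      · rw [show e i * e j = 0 from he.ortho h, zero_mul]
    · rw [Fintype.sum_prod_type, ← Finset.sum_mul_sum, he.complete, he'.complete, one_mul]
  · rintro ⟨i, i'⟩ s
    change Submodule.map (l ∘ₗ m) _ = _
    rw [Submodule.map_comp, map_block_mul m _ _ _ _ (hσ' i' s), mul_comm,
      map_block_mul l _ _ _ _ (hσ i (σ' i' s))]
    rfl

lemma PermutesBy.inv {ι : Type u} {R : CommAlgCat.{u} F} {W : ι → Submodule F V}
    {φ : (glScheme F V).obj R} {e : R} {σ : Equiv.Perm ι} (h : PermutesBy W (glEnd φ) e σ) :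
    PermutesBy W (glEnd φ⁻¹) e σ⁻¹ := by
  intro s
  have := h (σ⁻¹ s)
  rw [show σ (σ⁻¹ s) = s from σ.apply_symm_apply s] at this
  rw [← this, ← Submodule.map_comp]
  convert Submodule.map_id _
  refine LinearMap.ext fun x => ?_
  exact glEnd_inv_apply φ x

lemma PermutesLocally.inv {ι : Type u} {R : CommAlgCat.{u} F} {W : ι → Submodule F V}
    {φ : (glScheme F V).obj R} (h : PermutesLocally W (glEnd φ)) :
    PermutesLocally W (glEnd φ⁻¹) := by
  obtain ⟨n, e, σ, hne, he, hσ⟩ := h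
  exact ⟨n, e, fun i => (σ i)⁻¹, hne, he, fun i => (hσ i).inv⟩

lemma PermutesLocally.extend {ι : Type u} {R S : CommAlgCat.{u} F} (f : R ⟶ S)
    {W : ι → Submodule F V} {l : Module.End R (R ⊗[F] V)} (h : PermutesLocally W l) :
    PermutesLocally W (extend f l) := by
  obtain ⟨n, e, σ, -, he, hσ⟩ := h
  exact .of_fintype (fun i => f.hom (e i)) σ (he.map f.hom.toRingHom)
    fun i s => map_block_extend f l _ _ _ (hσ i s)

/-- The group scheme `GL(V, Γ)` of a family `Γ = (V_s)` of (nonzero) subspaces. -/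
def glPermuting {ι : Type u} (W : ι → Submodule F V) : SubgroupFunctor (glScheme F V) where
  pts R :=
    { carrier := {φ | PermutesLocally W (glEnd φ)}
      mul_mem' := fun hφ hψ => hφ.mul hψ
      one_mem' := .one W
      inv_mem' := fun hφ => hφ.inv }
  map_mem f _ hφ := PermutesLocally.extend f hφ

end LinearGroups

/-! ### Automorphism group schemes of nonassociative algebras -/

section Alg

variable (F)
variable (A : Type u) [NonUnitalNonAssocRing A] [Module F A] [IsScalarTower F A A]
  [SMulCommClass F A A]

lemma base_mul {R S : CommAlgCat.{u} F} (f : R ⟶ S) (x y : R ⊗[F] A) :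
    base A f (x * y) = base A f x * base A f y := by
  induction x with
  | zero => simp
  | add x x' hx hx' => simp only [add_mul, map_add, hx, hx']
  | tmul a v =>
    induction y with
    | zero => simp
    | add x x' hx hx' => simp only [mul_add, map_add, hx, hx']
    | tmul b w => simp

/-- An `S`-linear endomorphism of `S ⊗ A` is multiplicative as soon as it is so on tensors `1 ⊗ a`. -/
lemma mul_of_one_tmul {S : CommAlgCat.{u} F} (l : Module.End S (S ⊗[F] A))
    (h : ∀ a b : A, l (((1 : S) ⊗ₜ[F] a) * ((1 : S) ⊗ₜ[F] b)) = l (1 ⊗ₜ a) * l (1 ⊗ₜ b))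
    (x y : S ⊗[F] A) : l (x * y) = l x * l y := by
  induction x with
  | zero => simp
  | add x x' hx hx' => simp only [add_mul, map_add, hx, hx']
  | tmul r a =>
    induction y with
    | zero => simp
    | add x x' hx hx' => simp only [mul_add, map_add, hx, hx']
    | tmul t b =>
      have e₁ : r ⊗ₜ[F] a = r • ((1 : S) ⊗ₜ[F] a) := by simp [TensorProduct.smul_tmul']
      have e₂ : t ⊗ₜ[F] b = t • ((1 : S) ⊗ₜ[F] b) := by simp [TensorProduct.smul_tmul']
      rw [e₁, e₂, smul_mul_assoc, mul_smul_comm, map_smul, map_smul, h, map_smul, map_smul,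
        smul_mul_assoc, mul_smul_comm]

/-- `Aut(A)` as a subgroup functor of `GL(A)`: its `R`-points are the `R`-linear automorphisms
of `R ⊗ A` that respect the multiplication. -/
def autSub : SubgroupFunctor (glScheme F A) where
  pts R :=
    { carrier := {φ | ∀ x y : R ⊗[F] A, glEnd φ (x * y) = glEnd φ x * glEnd φ y}
      mul_mem' := by
        intro φ ψ hφ hψ x y
        rw [glEnd_mul, Module.End.mul_apply, hψ, hφ]
        rfl
      one_mem' := fun _ _ => rfl
      inv_mem' := by
        intro φ hφ x y
        rw [← glEnd_apply_inv φ x, ← glEnd_apply_inv φ y, ← hφ]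
        simp only [glEnd_inv_apply] }
  map_mem {R S} f φ hφ := by
    change ∀ x y, extend f (glEnd φ) (x * y) = _
    apply mul_of_one_tmul
    intro a b
    rw [← base_one f, ← base_one f, ← base_mul, extend_base, hφ, base_mul]
    change _ = extend f (glEnd φ) _ * extend f (glEnd φ) _
    rw [extend_base, extend_base]

/-- The automorphism group scheme `Aut(A)`, `R ↦ Aut_R(R ⊗ A)`. -/
def autScheme : GroupFunctor F := (autSub F A).toFunctor

variable {F A}

/-- The endomorphism of `R ⊗ A` underlying an element of `Aut(A)(R)`. -/
abbrev autEnd {R : CommAlgCat.{u} F} (φ : (autScheme F A).obj R) : Module.End R (R ⊗[F] A) :=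
  glEnd (V := A) (((autSub F A).incl.app R).hom φ)

lemma autEnd_map {R S : CommAlgCat.{u} F} (f : R ⟶ S) (φ : (autScheme F A).obj R) :
    autEnd (((autScheme F A).map f).hom φ) = extend f (autEnd φ) := rfl

lemma autEnd_mul {R : CommAlgCat.{u} F} (φ ψ : (autScheme F A).obj R) :
    autEnd (φ * ψ) = autEnd φ * autEnd ψ := rfl

lemma autEnd_one {R : CommAlgCat.{u} F} : autEnd (1 : (autScheme F A).obj R) = 1 := rfl

lemma autEnd_inv_apply {R : CommAlgCat.{u} F} (φ : (autScheme F A).obj R) (x : R ⊗[F] A) :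
    autEnd φ⁻¹ (autEnd φ x) = x := by
  rw [← Module.End.mul_apply, ← autEnd_mul, inv_mul_cancel, autEnd_one, Module.End.one_apply]

lemma autEnd_ext {R : CommAlgCat.{u} F} {φ ψ : (autScheme F A).obj R}
    (h : autEnd φ = autEnd ψ) : φ = ψ :=
  Subtype.ext (Units.ext h)

/-- An element of `Aut(A)(R)` from an invertible multiplicative endomorphism. -/
def autMk {R : CommAlgCat.{u} F} (l : (Module.End R (R ⊗[F] A))ˣ)
    (h : ∀ x y, l.1 (x * y) = l.1 x * l.1 y) : (autScheme F A).obj R :=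
  (⟨l, h⟩ : (autSub F A).pts R)

end Alg

/-! ### Gradings -/

variable (F)

open Classical in
/-- A grading of the algebra `A` by the abelian group `U` (written multiplicatively). -/
@[ext]
structure Grading (U : Type u) [CommGroup U] (A : Type u) [NonUnitalNonAssocRing A]
    [Module F A] where
  comp : U → Submodule F A
  isInternal : DirectSum.IsInternal comp
  mul_mem : ∀ {g h : U} {a b : A}, a ∈ comp g → b ∈ comp h → a * b ∈ comp (g * h)

/-- The diagonalizable group scheme `D(U)`, represented by the group algebra `F[U]`:
its `R`-points are the characters `U → Rˣ`. -/
def diagScheme (U : Type u) [CommGroup U] : GroupFunctor F where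
  obj R := GrpCat.of (U →* Rˣ)
  map {R S} f := GrpCat.ofHom
    { toFun := fun χ => (Units.map (f.hom : R →* S)).comp χ
      map_one' := by ext; simp
      map_mul' := fun χ ψ => by ext; simp }
  map_id R := by ext χ g; rfl
  map_comp f g := by ext χ g; rfl

variable {F}

namespace Grading

variable {U : Type u} [CommGroup U] {A : Type u} [NonUnitalNonAssocRing A] [Module F A]
  (Γ : Grading F U A)

/-- The support `{g | A_g ≠ 0}`, as a type. -/
def supp : Type u := {g : U // Γ.comp g ≠ ⊥}

/-- The family of nonzero homogeneous components. -/
def nzComp (s : Γ.supp) : Submodule F A := Γ.comp s.1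

/-- A grading is fine if no grading by an abelian group refines it properly. (The subgroup
generated by the support of a grading of a finite-dimensional algebra is finitely generated, so
there is no loss in fixing the universe of the group.) -/
def IsFine : Prop :=
  ¬ ∃ (H : Type u) (_ : CommGroup H) (Δ : Grading F H A),
    (∀ h, Δ.comp h ≠ ⊥ → ∃ g, Δ.comp h ≤ Γ.comp g) ∧
      ∃ h g, Δ.comp h ≠ ⊥ ∧ Δ.comp h < Γ.comp g

lemma iSup_comp : ⨆ g, Γ.comp g = ⊤ := by
  classical
  exact Γ.isInternal.submodule_iSup_eq_top

lemma hom_induction {p : A → Prop} (hom : ∀ g, ∀ a ∈ Γ.comp g, p a) (zero : p 0)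
    (add : ∀ a b, p a → p b → p (a + b)) (a : A) : p a :=
  Submodule.iSup_induction Γ.comp (motive := p) (by rw [iSup_comp]; trivial) hom zero add

open Classical in
/-- The linear map `A → N` given by linear maps on the homogeneous components. -/
def glue {N : Type*} [AddCommGroup N] [Module F N] (l : U → A →ₗ[F] N) : A →ₗ[F] N :=
  DirectSum.toModule F U N (fun g => l g ∘ₗ (Γ.comp g).subtype) ∘ₗ
    (LinearEquiv.ofBijective (DirectSum.coeLinearMap Γ.comp) Γ.isInternal).symm.toLinearMap

lemma glue_apply {N : Type*} [AddCommGroup N] [Module F N] (l : U → A →ₗ[F] N) {g : U} {a : A}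
    (ha : a ∈ Γ.comp g) : Γ.glue l a = l g a := by
  classical
  have h : (LinearEquiv.ofBijective (DirectSum.coeLinearMap Γ.comp) Γ.isInternal).symm a =
      DirectSum.lof F U (fun g => Γ.comp g) g ⟨a, ha⟩ := by
    rw [LinearEquiv.symm_apply_eq]
    exact (DirectSum.coeLinearMap_lof Γ.comp g ⟨a, ha⟩).symm
  rw [glue, LinearMap.comp_apply, LinearEquiv.coe_coe, h, DirectSum.toModule_lof]
  rfl

/-- The endomorphism `τ_χ` of `R ⊗ A`: multiplication by `χ(g)` on `R ⊗ A_g`. -/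
def tau {R : CommAlgCat.{u} F} (χ : U →* Rˣ) : Module.End R (R ⊗[F] A) :=
  LinearMap.liftBaseChange R (Γ.glue fun g => TensorProduct.mk F R A (χ g : R))

lemma tau_one_tmul {R : CommAlgCat.{u} F} (χ : U →* Rˣ) {g : U} {a : A} (ha : a ∈ Γ.comp g) :
    Γ.tau χ ((1 : R) ⊗ₜ a) = (χ g : R) • ((1 : R) ⊗ₜ[F] a) := by
  simp [tau, Γ.glue_apply _ ha, TensorProduct.smul_tmul']

lemma end_ext_hom {R : CommAlgCat.{u} F} {l m : Module.End R (R ⊗[F] A)}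
    (h : ∀ g, ∀ a ∈ Γ.comp g, l ((1 : R) ⊗ₜ a) = m ((1 : R) ⊗ₜ a)) : l = m := by
  apply end_ext
  intro a
  refine Γ.hom_induction h (by simp) (fun a b ha hb => ?_) a
  rw [TensorProduct.tmul_add, map_add, map_add, ha, hb]

/-- `χ ↦ τ_χ` as a homomorphism of monoids. -/
def tauHom (R : CommAlgCat.{u} F) : (U →* Rˣ) →* Module.End R (R ⊗[F] A) where
  toFun := Γ.tau
  map_one' := Γ.end_ext_hom fun g a ha => by simp [Γ.tau_one_tmul _ ha]
  map_mul' χ ψ := Γ.end_ext_hom fun g a ha => by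
    rw [Module.End.mul_apply, Γ.tau_one_tmul _ ha, Γ.tau_one_tmul _ ha, map_smul,
      Γ.tau_one_tmul _ ha, smul_smul, MonoidHom.mul_apply, Units.val_mul, mul_comm]

section

variable [IsScalarTower F A A] [SMulCommClass F A A]

lemma tau_mul {R : CommAlgCat.{u} F} (χ : U →* Rˣ) (x y : R ⊗[F] A) :
    Γ.tau χ (x * y) = Γ.tau χ x * Γ.tau χ y := by
  refine mul_of_one_tmul F A (Γ.tau χ) (fun a b => ?_) x y
  induction a using Γ.hom_induction with
  | zero => simp only [TensorProduct.tmul_zero, zero_mul, map_zero]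
  | add a a' h h' => rw [TensorProduct.tmul_add, add_mul, map_add, map_add, add_mul, h, h']
  | hom g a ha =>
  induction b using Γ.hom_induction with
  | zero => simp only [TensorProduct.tmul_zero, mul_zero, map_zero]
  | add a a' h h' => rw [TensorProduct.tmul_add, mul_add, map_add, map_add, mul_add, h, h']
  | hom h b hb =>
  rw [Algebra.TensorProduct.tmul_mul_tmul, one_mul, Γ.tau_one_tmul χ (Γ.mul_mem ha hb),
    Γ.tau_one_tmul χ ha, Γ.tau_one_tmul χ hb, smul_mul_assoc, mul_smul_comm, smul_smul,
    Algebra.TensorProduct.tmul_mul_tmul, one_mul, map_mul, Units.val_mul]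

/-- The morphism `η_Γ : D(U) → Aut(A)` associated with a `U`-grading `Γ` of `A`. -/
def eta : diagScheme F U ⟶ autScheme F A where
  app R := GrpCat.ofHom
    ((((Γ.tauHom R).toHomUnits).codRestrict ((autSub F A).pts R) (fun χ => Γ.tau_mul χ)) :
      (U →* Rˣ) →* (autSub F A).pts R)
  naturality {R S} f := by
    ext χ
    apply autEnd_ext
    change Γ.tau ((Units.map (f.hom : R →* S)).comp χ) = extend f (Γ.tau χ)
    refine Γ.end_ext_hom fun g a ha => ?_
    rw [Γ.tau_one_tmul _ ha, ← base_one f, extend_base]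
    have h := Γ.tau_one_tmul (R := R) χ ha
    refine Eq.trans ?_ (congrArg (base A f) h).symm
    rw [base_smul]
    rfl

/-- The stabilizer `Stab(Γ)`: automorphisms `φ` of `R ⊗ A` with `φ(R ⊗ A_g) = R ⊗ A_g` for
all `g`. -/
def stab : SubgroupFunctor (autScheme F A) where
  pts R :=
    { carrier := {φ | ∀ g, ((Γ.comp g).baseChange R).map (autEnd φ) = (Γ.comp g).baseChange R}
      mul_mem' := by
        intro φ ψ hφ hψ g
        rw [autEnd_mul, Module.End.mul_eq_comp, Submodule.map_comp, hψ, hφ]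
      one_mem' := fun g => Submodule.map_id _
      inv_mem' := by
        intro φ hφ g
        conv_lhs => rw [← hφ g, ← Submodule.map_comp]
        convert Submodule.map_id _
        refine LinearMap.ext fun x => ?_
        exact autEnd_inv_apply φ x }
  map_mem {R S} f φ hφ g := by
    have h := map_block_extend f (autEnd φ) (Γ.comp g) (Γ.comp g) 1 (by
      rw [block_one]; exact hφ g)
    rw [map_one, block_one] at h
    exact h

/-- The diagonal group scheme `Diag(Γ)`: automorphisms of `R ⊗ A` acting on each `R ⊗ A_g` as
multiplication by an invertible scalar. -/
def diag : SubgroupFunctor (autScheme F A) where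
  pts R :=
    { carrier := {φ | ∀ g, ∃ r : Rˣ, ∀ x ∈ (Γ.comp g).baseChange R, autEnd φ x = (r : R) • x}
      mul_mem' := by
        intro φ ψ hφ hψ g
        obtain ⟨r, hr⟩ := hφ g
        obtain ⟨t, ht⟩ := hψ g
        refine ⟨r * t, fun x hx => ?_⟩
        rw [autEnd_mul, Module.End.mul_apply, ht x hx, map_smul, hr x hx, smul_smul,
          Units.val_mul, mul_comm]
      one_mem' := fun g => ⟨1, fun x _ => by simp [autEnd_one]⟩
      inv_mem' := by
        intro φ hφ g
        obtain ⟨r, hr⟩ := hφ g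
        refine ⟨r⁻¹, fun x hx => ?_⟩
        have h := congrArg (autEnd φ⁻¹) (hr x hx)
        rw [autEnd_inv_apply, map_smul] at h
        conv_rhs => rw [h]
        rw [smul_smul, Units.inv_mul, one_smul] }
  map_mem {R S} f φ hφ g := by
    obtain ⟨r, hr⟩ := hφ g
    refine ⟨Units.map (f.hom : R →* S) r, fun x hx => ?_⟩
    rw [Submodule.baseChange_eq_span] at hx
    induction hx using Submodule.span_induction with
    | mem x h =>
      obtain ⟨w, hw, rfl⟩ := h
      rw [TensorProduct.mk_apply, ← base_one f, autEnd_map, extend_base,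
        hr _ (Submodule.tmul_mem_baseChange_of_mem _ hw), base_smul]
      rfl
    | zero => simp
    | add x y _ _ hx hy => rw [map_add, hx, hy, smul_add]
    | smul t x _ hx => rw [map_smul, hx, smul_comm]

/-- `U` is the universal group of the `U`-grading `Γ`: the morphism `η_Γ` maps `D(U)`
isomorphically onto `Diag(Γ)`. -/
def IsUniversal : Prop :=
  ∃ i : diagScheme F U ≅ Γ.diag.toFunctor, i.hom ≫ Γ.diag.incl = Γ.eta

/-- The automorphism group scheme `Aut(Γ) = Aut(A) ∩ GL(A, Γ)`. -/
def aut : SubgroupFunctor (autScheme F A) where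
  pts R := ((glPermuting Γ.nzComp).pts R).comap ((autSub F A).incl.app R).hom
  map_mem f _ hφ := (glPermuting Γ.nzComp).map_mem f _ hφ

end

open Classical in
/-- The projection of `A` onto the homogeneous component `A_g`. -/
def proj (g : U) : A →ₗ[F] A := Γ.glue fun h => if h = g then LinearMap.id else 0

lemma block_injective {R : CommAlgCat.{u} F} {e : R} (he : e ≠ 0) {g h : U}
    (hg : Γ.comp g ≠ ⊥) (H : block R (Γ.comp g) e ≤ block R (Γ.comp h) e) : g = h := by
  by_contra hgh
  obtain ⟨a, ha, ha0⟩ := (Submodule.ne_bot_iff _).1 hg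
  have h1 : e ⊗ₜ[F] a ∈ block R (Γ.comp h) e :=
    H ⟨(1 : R) ⊗ₜ a, Submodule.tmul_mem_baseChange_of_mem _ ha, by
      simp [TensorProduct.smul_tmul']⟩
  obtain ⟨y, ⟨z, rfl⟩, hy⟩ := h1
  have h2 : (Γ.proj g).baseChange R (e ⊗ₜ[F] a) = 0 := by
    rw [← hy, LinearMap.lsmul_apply, map_smul]
    suffices h : (Γ.proj g ∘ₗ (Γ.comp h).subtype) = 0 by
      rw [← LinearMap.comp_apply, ← LinearMap.baseChange_comp, h]
      simp
    ext b
    simp [proj, Γ.glue_apply _ b.2, Ne.symm hgh]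
  rw [LinearMap.baseChange_tmul, proj, Γ.glue_apply _ ha, if_pos rfl, LinearMap.id_apply] at h2
  obtain ⟨l, hl⟩ := Module.Projective.exists_dual_eq_one F ha0
  have h3 := congrArg (fun x => TensorProduct.rid F R (l.lTensor R x)) h2
  simp only [LinearMap.lTensor_tmul, hl, TensorProduct.rid_tmul, one_smul, map_zero] at h3
  exact he h3

/-- At the prime `p`, the endomorphism `l` permutes the nonzero components according to `σ`:
this holds over some basic neighbourhood `D(e)` of `p` in `Spec R`. -/
def HasPermAt {R : CommAlgCat.{u} F} (l : Module.End R (R ⊗[F] A)) (p : PrimeSpectrum R)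
    (σ : Equiv.Perm Γ.supp) : Prop :=
  ∃ e : R, e ∉ p.asIdeal ∧ PermutesBy Γ.nzComp l e σ

variable {Γ}

lemma HasPermAt.unique {R : CommAlgCat.{u} F} {l : Module.End R (R ⊗[F] A)}
    {p : PrimeSpectrum R} {σ σ' : Equiv.Perm Γ.supp} (h : Γ.HasPermAt l p σ)
    (h' : Γ.HasPermAt l p σ') : σ = σ' := by
  obtain ⟨e, he, hσ⟩ := h
  obtain ⟨e', he', hσ'⟩ := h'
  have hne : e' * e ≠ 0 := fun h0 => by
    have : e' * e ∈ p.asIdeal := by rw [h0]; exact zero_mem _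
    exact (p.isPrime.mem_or_mem this).elim he' he
  ext1 s
  apply Subtype.ext
  refine Γ.block_injective hne (σ s).2 (le_of_eq ?_)
  have h1 := map_block_mul l _ _ e' _ (hσ s)
  have h2 := map_block_mul l _ _ e _ (hσ' s)
  rw [mul_comm e e'] at h2
  exact h1.symm.trans h2

lemma HasPermAt.exists {R : CommAlgCat.{u} F} {l : Module.End R (R ⊗[F] A)}
    (h : PermutesLocally Γ.nzComp l) (p : PrimeSpectrum R) : ∃ σ, Γ.HasPermAt l p σ := by
  obtain ⟨n, e, σ, -, he, hσ⟩ := h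
  by_contra! H
  refine p.isPrime.one_notMem ?_
  rw [← he.complete]
  refine sum_mem fun i _ => ?_
  by_contra hi
  exact H (σ i) ⟨e i, hi, hσ i⟩

lemma HasPermAt.mul {R : CommAlgCat.{u} F} {l m : Module.End R (R ⊗[F] A)}
    {p : PrimeSpectrum R} {σ τ : Equiv.Perm Γ.supp} (h : Γ.HasPermAt l p σ)
    (h' : Γ.HasPermAt m p τ) : Γ.HasPermAt (l * m) p (σ * τ) := by
  obtain ⟨e, he, hσ⟩ := h
  obtain ⟨e', he', hτ⟩ := h'
  refine ⟨e * e', fun H => (p.isPrime.mem_or_mem H).elim he he', fun s => ?_⟩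
  rw [Module.End.mul_eq_comp, Submodule.map_comp, map_block_mul m _ _ _ _ (hτ s), mul_comm,
    map_block_mul l _ _ _ _ (hσ (τ s))]
  rfl

lemma HasPermAt.extend {R S : CommAlgCat.{u} F} (f : R ⟶ S) {l : Module.End R (R ⊗[F] A)}
    {p : PrimeSpectrum S} {σ : Equiv.Perm Γ.supp}
    (h : Γ.HasPermAt l (PrimeSpectrum.comap f.hom.toRingHom p) σ) :
    Γ.HasPermAt (extend f l) p σ := by
  obtain ⟨e, he, hσ⟩ := h
  exact ⟨f.hom e, he, fun s => map_block_extend f l _ _ _ (hσ s)⟩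

variable (Γ)

/-- The locally constant function on `Spec R` with values in `Sym(Supp Γ)` attached to an
endomorphism of `R ⊗ A` that permutes the components locally. -/
def permOf {R : CommAlgCat.{u} F} (l : Module.End R (R ⊗[F] A))
    (h : PermutesLocally Γ.nzComp l) : LocallyConstant (PrimeSpectrum R) (Equiv.Perm Γ.supp) where
  toFun p := (HasPermAt.exists h p).choose
  isLocallyConstant := by
    rw [IsLocallyConstant.iff_exists_open]
    intro p
    obtain ⟨e, he, hσ⟩ := (HasPermAt.exists h p).choose_spec
    exact ⟨PrimeSpectrum.basicOpen e, (PrimeSpectrum.basicOpen e).2, he, fun q hq =>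
      (HasPermAt.exists h q).choose_spec.unique ⟨e, hq, hσ⟩⟩

lemma permOf_spec {R : CommAlgCat.{u} F} (l : Module.End R (R ⊗[F] A))
    (h : PermutesLocally Γ.nzComp l) (p : PrimeSpectrum R) : Γ.HasPermAt l p (Γ.permOf l h p) :=
  (HasPermAt.exists h p).choose_spec

end Grading

/-- The constant group scheme of a group `H`: its `R`-points are the locally constant functions
`Spec R → H` (so just `H` if `Spec R` is connected, i.e. if `R ≠ 0` has no proper idempotents). -/
def constScheme (F : Type u) [Field F] (H : Type u) [Group H] : GroupFunctor F where
  obj R := GrpCat.of (LocallyConstant (PrimeSpectrum R) H)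
  map f := GrpCat.ofHom
    { toFun := LocallyConstant.comap
        ⟨PrimeSpectrum.comap f.hom.toRingHom, PrimeSpectrum.continuous_comap _⟩
      map_one' := rfl
      map_mul' := fun _ _ => rfl }
  map_id _ := rfl
  map_comp _ _ := rfl

namespace Grading

variable {U : Type u} [CommGroup U] {A : Type u} [NonUnitalNonAssocRing A] [Module F A]
  [IsScalarTower F A A] [SMulCommClass F A A] (Γ : Grading F U A)

/-- The natural morphism from `Aut(Γ)` to the constant group scheme of `Sym(Supp Γ)`. -/
def toSym : Γ.aut.toFunctor ⟶ constScheme F (Equiv.Perm Γ.supp) where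
  app R := GrpCat.ofHom (MonoidHom.mk'
    (M := Γ.aut.pts R) (G := LocallyConstant (PrimeSpectrum R) (Equiv.Perm Γ.supp))
    (fun φ => Γ.permOf (autEnd φ.1) φ.2) (fun φ ψ => by
      ext1 p
      exact (Γ.permOf_spec _ _ p).unique ((Γ.permOf_spec _ _ p).mul (Γ.permOf_spec _ _ p))))
  naturality {R S} f := by
    apply GrpCat.ext
    intro φ
    refine LocallyConstant.ext fun p => ?_
    exact (Γ.permOf_spec _ (Γ.aut.map_mem f φ.1 φ.2) p).unique
      ((Γ.permOf_spec (autEnd φ.1) φ.2 (PrimeSpectrum.comap f.hom.toRingHom p)).extend f)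

/-- The Weyl group scheme `W(Γ)`: the image of `Aut(Γ) → Sym(Supp Γ)`. -/
def weyl : SubgroupFunctor (constScheme F (Equiv.Perm Γ.supp)) :=
  SubgroupFunctor.image Γ.toSym

/-- The canonical morphism `Aut(Γ) → W(Γ)`. -/
def toWeyl : Γ.aut.toFunctor ⟶ Γ.weyl.toFunctor :=
  SubgroupFunctor.toImage Γ.toSym

end Grading

end

end GradingScheme

/-!
The theorem holds because the data attached to `Γ` can be read off from the morphism
`η_Γ : D(U) → Aut(A)` alone, so that they are carried along by any isomorphism of group schemes.

A morphism `f : D(U) → Aut(B)` is determined by the action of the generic character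
`U → F[U]ˣ`, that is, by a coaction `B → F[U] ⊗ B`; comparing the two ways of letting
`D(U × U)` act shows that `B` is the direct sum of the spaces on which the generic character acts
as multiplication by `u`. So `f = η_Γ'` for a unique grading `Γ'` (`Grading.eta_ofHom`,
`Grading.eta_injective`).

If a grading `Δ` by `H` refines `Γ'` along a homomorphism `H → U`, then its transport to `A` refines
`Γ`, which is fine, so the points of `D(H)` act on `A` through `Diag(Γ) = D(U)`, hence also on
`B` through `D(U)` (`Grading.exists_act_eq_of_refinement`). A refinement that is not given along a
homomorphism becomes one after regrading by `(i, r i) ∈ I × K`, where `r` is multiplicative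
wherever products of components are nonzero (`Grading.graph`). With `K = Rˣ` and `r` the scalars
of a point of `Diag(Γ')(R)` this gives `Diag(Γ') = η_Γ'(D(U))` (`Grading.DiagLeEta.transport`);
with `K = U` and an arbitrary refinement it gives that `Γ'` is fine (`Grading.IsFine.transport`).

`Stab(Γ)` is the centralizer of `η_Γ(D(U))` (`Grading.mem_stab_iff`), and `Aut(Γ)` is its
normalizer when `η_Γ(D(U)) = Diag(Γ)` (`Grading.mem_aut_iff`). If `x` normalizes, so that
`η(gen) x = x η(χ)` over `R[U]`, then the projection to `A_u` acts on `x(R ⊗ A_g)` as the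
coefficient of `χ(g) ∈ R[U]` at `u`; these coefficients are the idempotents in the definition of
`Aut(Γ)`.

Finally, the image of a morphism `f` to the constant group scheme of `H` is the constant group
scheme of the subgroup of the values which `f` takes (`mem_image_iff`), and two morphisms with the
same kernel take isomorphic groups of values (`exists_image_iso`). This applies to `Aut(Γ)` and
`Aut(Γ')`, the kernels being `Stab(Γ)` and `Stab(Γ')` (`Grading.toSym_eq_one_iff`).
-/

/-! ### The coaction of a morphism from a diagonalizable group scheme -/

namespace GradingScheme
noncomputable section
variable {F : Type u} [Field F]

section Tensor

variable {V : Type u} [AddCommGroup V] [Module F V]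

lemma tmul_right_injective {R : Type u} [CommRing R] [Algebra F R] {v : V} (hv : v ≠ 0) :
    Function.Injective fun r : R => r ⊗ₜ[F] v := by
  intro s t h
  obtain ⟨l, hl⟩ := Module.Projective.exists_dual_eq_one F hv
  have h' := congrArg (fun x => TensorProduct.rid F R (l.lTensor R x)) h
  simpa [hl] using h'

variable (F) in
/-- The group algebra `R[U]` as a commutative `F`-algebra. -/
abbrev groupAlg (R : Type u) [CommRing R] [Algebra F R] (U : Type u) [CommGroup U] :
    CommAlgCat.{u} F :=
  CommAlgCat.of F (MonoidAlgebra R U)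

/-- The generic character `U → R[U]ˣ`. -/
def genericChar (R : Type u) [CommRing R] (U : Type u) [CommGroup U] :
    U →* (MonoidAlgebra R U)ˣ :=
  (MonoidAlgebra.of R U).toHomUnits

@[simp]
lemma genericChar_val (R : Type u) [CommRing R] (U : Type u) [CommGroup U] (g : U) :
    (genericChar R U g : MonoidAlgebra R U) = MonoidAlgebra.single g 1 := rfl

/-- The expansion `F[U] ⊗ V ≃ (U →₀ V)` in the basis of `F[U]` formed by the elements of `U`. -/
def expand (U : Type u) [CommGroup U] (V : Type u) [AddCommGroup V] [Module F V] :
    MonoidAlgebra F U ⊗[F] V ≃ₗ[F] (U →₀ V) := by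
  classical
  exact TensorProduct.congr (MonoidAlgebra.coeffLinearEquiv F) (LinearEquiv.refl F V) ≪≫ₗ
    TensorProduct.finsuppScalarLeft F V U

lemma expand_single {U : Type u} [CommGroup U] (g : U) (v : V) :
    expand U V (MonoidAlgebra.single g (1 : F) ⊗ₜ v) = Finsupp.single g v := by
  classical
  ext h
  simp only [expand, LinearEquiv.trans_apply, TensorProduct.congr_tmul,
    MonoidAlgebra.coeffLinearEquiv_apply, MonoidAlgebra.coeff_single, LinearEquiv.refl_apply,
    TensorProduct.finsuppScalarLeft_apply_tmul_apply, Finsupp.single_apply]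
  split_ifs <;> simp

lemma groupAlg_induction {U : Type u} [CommGroup U] {p : MonoidAlgebra F U ⊗[F] V → Prop}
    (single : ∀ g v, p (MonoidAlgebra.single g (1 : F) ⊗ₜ v)) (zero : p 0)
    (add : ∀ x y, p x → p y → p (x + y)) (z : MonoidAlgebra F U ⊗[F] V) : p z := by
  obtain ⟨w, rfl⟩ := (expand U V).symm.surjective z
  induction w using Finsupp.induction_linear with
  | zero => simpa using zero
  | add x y hx hy => rw [map_add]; exact add _ _ hx hy
  | single g v => rw [← expand_single (F := F), LinearEquiv.symm_apply_apply]; exact single g v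

lemma expand_single_smul {U : Type u} [CommGroup U] (g : U) (z : MonoidAlgebra F U ⊗[F] V)
    (h : U) : expand U V (MonoidAlgebra.single g (1 : F) • z) h = expand U V z (g⁻¹ * h) := by
  classical
  induction z using groupAlg_induction with
  | single k v =>
    rw [TensorProduct.smul_tmul', smul_eq_mul, MonoidAlgebra.single_mul_single, mul_one,
      expand_single, expand_single, Finsupp.single_apply, Finsupp.single_apply,
      eq_inv_mul_iff_mul_eq]
  | zero => simp
  | add x y hx hy => rw [smul_add, map_add, Finsupp.add_apply, hx, hy, map_add, Finsupp.add_apply]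

end Tensor

section Eval

variable {U : Type u} [CommGroup U]

/-- The homomorphism `F[U] → R` extending the character `χ`. -/
def evalChar {R : CommAlgCat.{u} F} (χ : U →* Rˣ) : groupAlg F F U ⟶ R :=
  CommAlgCat.ofHom (MonoidAlgebra.lift F R U ((Units.coeHom R).comp χ))

lemma evalChar_single {R : CommAlgCat.{u} F} (χ : U →* Rˣ) (g : U) :
    (evalChar χ).hom (MonoidAlgebra.single g (1 : F)) = χ g := by
  simp [evalChar]

lemma base_evalChar_single {V : Type u} [AddCommGroup V] [Module F V] {R : CommAlgCat.{u} F}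
    (χ : U →* Rˣ) (g : U) (v : V) :
    base V (evalChar χ) (MonoidAlgebra.single g (1 : F) ⊗ₜ[F] v) = (χ g : R) ⊗ₜ[F] v :=
  congrArg (· ⊗ₜ[F] v) (evalChar_single χ g)

lemma map_evalChar {R : CommAlgCat.{u} F} (χ : U →* Rˣ) :
    ((diagScheme F U).map (evalChar χ)).hom (genericChar F U) = χ := by
  refine MonoidHom.ext fun g => Units.ext ?_
  exact evalChar_single χ g

/-- The map `F[U] ⊗ V → F[U'] ⊗ V` induced by an injective homomorphism `α : U → U'` relabels
the coefficients along `α`. -/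
lemma expand_evalChar {U' : Type u} [CommGroup U'] {V : Type u} [AddCommGroup V] [Module F V]
    (α : U →* U') (hα : Function.Injective α) (z : MonoidAlgebra F U ⊗[F] V) :
    expand (F := F) U' V
        (base V (R := groupAlg F F U) (S := groupAlg F F U')
          (evalChar ((genericChar F U').comp α)) z) =
      (expand (F := F) U V z).embDomain ⟨α, hα⟩ := by
  induction z using groupAlg_induction with
  | single g v =>
    rw [base_evalChar_single, expand_single, Finsupp.embDomain_single]
    exact expand_single _ _
  | zero => simp
  | add x y hx hy =>
    rw [map_add, map_add, hx, hy, map_add]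
    exact ((Finsupp.embDomain.addMonoidHom _).map_add _ _).symm

end Eval

section Alg
variable {U : Type u} [CommGroup U] {B : Type u} [NonUnitalNonAssocRing B] [Module F B]
  [IsScalarTower F B B] [SMulCommClass F B B] (f : diagScheme F U ⟶ autScheme F B)

/-- The operator on `R ⊗ B` by which the character `χ` acts, for a morphism `D(U) → Aut(B)`. -/
def act {R : CommAlgCat.{u} F} (χ : U →* Rˣ) : Module.End R (R ⊗[F] B) :=
  autEnd ((f.app R).hom χ)

lemma act_one {R : CommAlgCat.{u} F} : act f (1 : U →* Rˣ) = 1 :=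
  congrArg autEnd ((f.app R).hom.map_one)

lemma act_mul {R : CommAlgCat.{u} F} (χ ψ : U →* Rˣ) : act f (χ * ψ) = act f χ * act f ψ :=
  congrArg autEnd ((f.app R).hom.map_mul χ ψ)

lemma act_apply_mul {R : CommAlgCat.{u} F} (χ : U →* Rˣ) (x y : R ⊗[F] B) :
    act f χ (x * y) = act f χ x * act f χ y :=
  ((f.app R).hom χ).2 x y

/-- The coaction `B → F[U] ⊗ B` attached to an action of `D(U)` on `B`. -/
def coaction : B →ₗ[F] (MonoidAlgebra F U ⊗[F] B) :=
  (act f (R := groupAlg F F U) (genericChar F U)).restrictScalars F ∘ₗ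
    TensorProduct.mk F (MonoidAlgebra F U) B 1

lemma coaction_apply (b : B) : coaction f b =
    act f (R := groupAlg F F U) (genericChar F U) ((1 : MonoidAlgebra F U) ⊗ₜ b) := rfl

/-- The coaction determines the action of every character, by Yoneda's lemma. -/
lemma act_one_tmul {R : CommAlgCat.{u} F} (χ : U →* Rˣ) (b : B) :
    act f χ ((1 : R) ⊗ₜ b) = base B (evalChar χ) (coaction f b) := by
  have h := ConcreteCategory.congr_hom (f.naturality (evalChar χ)) (genericChar F U)
  have h2 : (f.app R).hom χ =
      ((autScheme F B).map (evalChar χ)).hom ((f.app (groupAlg F F U)).hom (genericChar F U)) := by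
    refine Eq.trans ?_ h
    conv_lhs => rw [← map_evalChar χ]
    rfl
  rw [act, h2, autEnd_map, ← base_one (evalChar χ), extend_base]
  rfl

/-- The component of `b` of degree `u`, for all `u` at once. -/
def components : B →ₗ[F] (U →₀ B) := (expand U B).toLinearMap ∘ₗ coaction f

lemma components_apply (b : B) : components f b = expand U B (coaction f b) := rfl

lemma components_sum (b : B) : ((components f b).sum fun _ x => x) = b := by
  have h : ∀ z : MonoidAlgebra F U ⊗[F] B,
      TensorProduct.lid F B (base B (R := groupAlg F F U) (S := CommAlgCat.of F F)
        (evalChar (1 : U →* Fˣ)) z) =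
      (expand U B z).sum fun _ x => x := by
    intro z
    induction z using groupAlg_induction with
    | single g v =>
      rw [expand_single, Finsupp.sum_single_index rfl, base_evalChar_single]
      simp
    | zero => simp
    | add x y hx hy =>
      rw [map_add, map_add, hx, hy, map_add, Finsupp.sum_add_index'] <;> simp
  have h2 := act_one_tmul f (R := CommAlgCat.of F F) (1 : U →* Fˣ) b
  rw [components_apply, ← h, ← h2, act_one]
  simp

/-- Taking the component of degree `u` is idempotent: compare the two ways of letting
`D(U × U) = D(U) × D(U)` act. -/
lemma coaction_components (b : B) (u : U) :
    coaction f (components f b u) = MonoidAlgebra.single u (1 : F) ⊗ₜ components f b u := by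
  classical
  let T := groupAlg F F (U × U)
  let c₁ : U →* (MonoidAlgebra F (U × U))ˣ := (genericChar F (U × U)).comp (MonoidHom.inl U U)
  let c₂ : U →* (MonoidAlgebra F (U × U))ˣ := (genericChar F (U × U)).comp (MonoidHom.inr U U)
  let Δ : U →* U × U := (MonoidHom.id U).prod (MonoidHom.id U)
  have hΔ : Function.Injective Δ := fun x y h => congrArg Prod.fst h
  have hinr : Function.Injective (MonoidHom.inr U U) := fun x y h => congrArg Prod.snd h
  have h₁₂ : c₂ * c₁ = (genericChar F (U × U)).comp Δ := by
    simp only [c₁, c₂]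
    rw [← MonoidHom.comp_mul]
    congr 1
    ext x <;> simp [Δ]
  have k : ∀ (v : U) (z : MonoidAlgebra F U ⊗[F] B),
      expand (F := F) (U × U) B (act f (R := T) c₂ (base B (S := T) (evalChar c₁) z)) (u, v)
        = expand (F := F) U B (coaction f (expand (F := F) U B z u)) v := by
    intro v z
    induction z using groupAlg_induction with
    | single g w =>
      have e : base B (S := T) (evalChar c₁) (MonoidAlgebra.single g (1 : F) ⊗ₜ[F] w) =
          (MonoidAlgebra.single (g, (1 : U)) (1 : F) : T) • ((1 : T) ⊗ₜ[F] w) := by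
        rw [base_evalChar_single, TensorProduct.smul_tmul', smul_eq_mul, mul_one]
        rfl
      rw [e, map_smul, act_one_tmul, expand_single]
      refine (expand_single_smul _ _ _).trans ?_
      have e2 := expand_evalChar (MonoidHom.inr U U) hinr (coaction f w)
      refine (DFunLike.congr_fun e2 _).trans ?_
      by_cases hg : g = u
      · subst hg
        rw [Finsupp.single_eq_same]
        have : (g, (1 : U))⁻¹ * (g, v) = (⟨MonoidHom.inr U U, hinr⟩ : U ↪ U × U) v := by
          simp
        rw [this, Finsupp.embDomain_apply_self]
      · rw [Finsupp.single_eq_of_ne (Ne.symm hg), Finsupp.embDomain_of_notMem_range]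
        · simp
        · rintro ⟨x, hx⟩
          apply hg
          have := congrArg Prod.fst hx
          simp only [Function.Embedding.coeFn_mk, MonoidHom.inr_apply, Prod.fst_mul,
            Prod.fst_inv] at this
          exact (eq_of_inv_mul_eq_one this.symm)
    | zero => simp
    | add x y hx hy => simp only [map_add, Finsupp.add_apply, hx, hy]
  apply (expand (F := F) U B).injective
  ext v
  have hm : act f (R := T) c₂ (base B (S := T) (evalChar c₁) (coaction f b)) =
      base B (S := T) (evalChar ((genericChar F (U × U)).comp Δ)) (coaction f b) := by
    rw [← act_one_tmul, ← Module.End.mul_apply, ← act_mul, h₁₂, act_one_tmul]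
  rw [components_apply, ← k, hm, expand_single]
  refine (DFunLike.congr_fun (expand_evalChar Δ hΔ (coaction f b)) _).trans ?_
  by_cases huv : u = v
  · subst huv
    rw [Finsupp.single_eq_same]
    exact Finsupp.embDomain_apply_self _ _ _
  · rw [Finsupp.single_eq_of_ne (Ne.symm huv), Finsupp.embDomain_of_notMem_range]
    rintro ⟨x, hx⟩
    exact huv ((congrArg Prod.fst hx).symm.trans (congrArg Prod.snd hx))

end Alg
end
end GradingScheme

/-! ### Gradings and morphisms from diagonalizable group schemes -/

namespace GradingScheme
noncomputable section
variable {F : Type u} [Field F]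

open Classical in
/-- A family of subspaces is a direct sum decomposition as soon as there is a linear map with the
properties of the map sending a vector to the family of its components. -/
lemma isInternal_of_components {U V : Type*} [AddCommGroup V] [Module F V]
    {C : U → Submodule F V} (ρ : V →ₗ[F] (U →₀ V))
    (hρ : ∀ u, ∀ a ∈ C u, ρ a = Finsupp.single u a) (hC : ∀ a u, ρ a u ∈ C u)
    (hsum : ∀ a, ((ρ a).sum fun _ x => x) = a) : DirectSum.IsInternal C := by
  rw [DirectSum.isInternal_submodule_iff_iSupIndep_and_iSup_eq_top]
  constructor
  · rw [iSupIndep_iff_dfinsupp_lsum_injective, ← LinearMap.ker_eq_bot, LinearMap.ker_eq_bot']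
    intro x hx
    have key : ∀ y : Π₀ u, C u, ∀ v, ρ (DFinsupp.lsum ℕ (fun u => (C u).subtype) y) v = y v := by
      intro y v
      induction y using DFinsupp.induction with
      | h0 => simp
      | ha i b y _ _ ih =>
        rw [map_add, map_add, Finsupp.add_apply, ih]
        simp only [DFinsupp.lsum_single, Submodule.subtype_apply, hρ i _ b.2, DFinsupp.add_apply,
          Submodule.coe_add, add_left_inj]
        by_cases h : i = v
        · subst h; simp
        · simp [Finsupp.single_eq_of_ne (Ne.symm h), DFinsupp.single_eq_of_ne (Ne.symm h)]
    ext v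
    rw [← key x v, hx]
    simp
  · rw [eq_top_iff]
    rintro a -
    rw [← hsum a]
    exact Submodule.sum_mem _ fun u _ => Submodule.mem_iSup_of_mem u (hC a u)

namespace Grading

section OfHom

variable {U : Type u} [CommGroup U] {B : Type u} [NonUnitalNonAssocRing B] [Module F B]
  [IsScalarTower F B B] [SMulCommClass F B B]

/-- The grading attached to a morphism `f : D(U) → Aut(B)`: the component of degree `u` consists
of the `b` on which the generic character acts as multiplication by `u`. -/
def ofHom (f : diagScheme F U ⟶ autScheme F B) : Grading F U B where
  comp u := LinearMap.eqLocus (coaction f)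
    (TensorProduct.mk F (MonoidAlgebra F U) B (MonoidAlgebra.single u 1))
  isInternal := isInternal_of_components (components f)
    (fun u a ha => by
      rw [LinearMap.mem_eqLocus, TensorProduct.mk_apply] at ha
      rw [components_apply, ha, expand_single])
    (fun a u => coaction_components f a u) (components_sum f)
  mul_mem {g h a b} ha hb := by
    rw [LinearMap.mem_eqLocus, TensorProduct.mk_apply] at ha hb ⊢
    have h1 : coaction f (a * b) = coaction f a * coaction f b := by
      rw [coaction_apply, coaction_apply, coaction_apply, ← act_apply_mul]
      congr 1
      rw [Algebra.TensorProduct.tmul_mul_tmul, one_mul]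
    rw [h1, ha, hb, Algebra.TensorProduct.tmul_mul_tmul, MonoidAlgebra.single_mul_single, one_mul]

lemma mem_ofHom (f : diagScheme F U ⟶ autScheme F B) {u : U} {b : B} :
    b ∈ (ofHom f).comp u ↔ coaction f b = MonoidAlgebra.single u (1 : F) ⊗ₜ b := Iff.rfl

lemma act_eta (Γ : Grading F U B) {R : CommAlgCat.{u} F} (χ : U →* Rˣ) :
    act Γ.eta χ = Γ.tau χ := rfl

lemma hom_ext {f f' : diagScheme F U ⟶ autScheme F B}
    (h : ∀ (R : CommAlgCat.{u} F) (χ : U →* Rˣ), act f χ = act f' χ) : f = f' := by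
  ext R χ
  exact autEnd_ext (h R χ)

lemma eta_ofHom (f : diagScheme F U ⟶ autScheme F B) : (ofHom f).eta = f := by
  refine hom_ext fun R χ => (ofHom f).end_ext_hom fun g b hb => ?_
  rw [act_eta, tau_one_tmul _ _ hb, act_one_tmul, (mem_ofHom f).1 hb, base_evalChar_single,
    TensorProduct.smul_tmul', smul_eq_mul, mul_one]

variable (Γ : Grading F U B)

lemma components_eta {g : U} {a : B} (ha : a ∈ Γ.comp g) :
    components Γ.eta a = Finsupp.single g a := by
  rw [components_apply, coaction_apply, act_eta]
  refine (congrArg _ (Γ.tau_one_tmul (R := groupAlg F F U) _ ha)).trans ?_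
  rw [TensorProduct.smul_tmul', smul_eq_mul, mul_one, genericChar_val, expand_single]

lemma components_eta_apply_mem (a : B) (g : U) : components Γ.eta a g ∈ Γ.comp g := by
  classical
  induction a using Γ.hom_induction with
  | hom h a ha =>
    rw [Γ.components_eta ha, Finsupp.single_apply]
    split_ifs with e
    · exact e ▸ ha
    · exact zero_mem _
  | zero => simp
  | add a b h h' => rw [map_add, Finsupp.add_apply]; exact add_mem h h'

lemma components_eta_sum (a : B) : ((components Γ.eta a).sum fun _ x => x) = a :=
  components_sum _ a

/-- The grading is recovered from the action of the generic character. -/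
lemma mem_comp_iff {g : U} {a : B} : a ∈ Γ.comp g ↔
    coaction Γ.eta a = MonoidAlgebra.single g (1 : F) ⊗ₜ a := by
  have e : coaction Γ.eta a = MonoidAlgebra.single g (1 : F) ⊗ₜ a ↔
      components Γ.eta a = Finsupp.single g a := by
    rw [components_apply, ← expand_single (F := F) g a, EmbeddingLike.apply_eq_iff_eq]
  rw [e]
  refine ⟨Γ.components_eta, fun h => ?_⟩
  have := Γ.components_eta_apply_mem a g
  rwa [h, Finsupp.single_eq_same] at this

/-- A grading is determined by its morphism `η`. -/
lemma eta_injective {Γ Γ' : Grading F U B} (h : Γ.eta = Γ'.eta) : Γ = Γ' := by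
  ext g a
  rw [mem_comp_iff, mem_comp_iff, h]

/-- If the action of `D(U)` given by `Γ` is the action of `D(H)` given by `Δ` composed with
`D(π) : D(U) → D(H)`, then `Δ` refines `Γ` along `π`. -/
lemma comp_le_of_act_eq {H : Type u} [CommGroup H] (Δ : Grading F H B) (π : H →* U)
    (h : ∀ (R : CommAlgCat.{u} F) (χ : U →* Rˣ), act Γ.eta χ = act Δ.eta (χ.comp π)) (k : H) :
    Δ.comp k ≤ Γ.comp (π k) := by
  intro a ha
  rw [mem_comp_iff, coaction_apply, h (groupAlg F F U), act_eta]
  refine (Δ.tau_one_tmul (R := groupAlg F F U) _ ha).trans ?_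
  rw [TensorProduct.smul_tmul', smul_eq_mul, mul_one]
  rfl

lemma act_eq_of_comp_le {H : Type u} [CommGroup H] (Δ : Grading F H B) (π : H →* U)
    (h : ∀ k, Δ.comp k ≤ Γ.comp (π k)) {R : CommAlgCat.{u} F} (χ : U →* Rˣ) :
    act Γ.eta χ = act Δ.eta (χ.comp π) := by
  refine Δ.end_ext_hom fun k a ha => ?_
  rw [act_eta, act_eta, Δ.tau_one_tmul _ ha, Γ.tau_one_tmul _ (h k ha)]
  rfl

end OfHom

section Regrade

variable {I K : Type u} [CommGroup I] [CommGroup K] {B : Type u} [NonUnitalNonAssocRing B]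
  [Module F B] [IsScalarTower F B B] [SMulCommClass F B B]

open Classical in
/-- The regrading `B_i ↦ B_(i, r i)` along the graph of a map `r` which is multiplicative wherever
the product of two components is nonzero. -/
def graph (Γ : Grading F I B) (r : I → K)
    (hr : ∀ i j, ∀ a ∈ Γ.comp i, ∀ b ∈ Γ.comp j, a * b ≠ 0 → r (i * j) = r i * r j) :
    Grading F (I × K) B where
  comp p := if p.2 = r p.1 then Γ.comp p.1 else ⊥
  isInternal := by
    have e : Function.Injective fun i => (i, r i) := fun i j h => congrArg Prod.fst h
    refine isInternal_of_components
      (Finsupp.lmapDomain B F (fun i => (i, r i)) ∘ₗ components Γ.eta) ?_ ?_ ?_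
    · rintro ⟨i, k⟩ a ha
      dsimp only at ha
      split_ifs at ha with h
      · subst h
        rw [LinearMap.comp_apply, Γ.components_eta ha, Finsupp.lmapDomain_apply,
          Finsupp.mapDomain_single]
      · rw [(Submodule.mem_bot F).1 ha]; simp
    · rintro a ⟨i, k⟩
      rw [LinearMap.comp_apply, Finsupp.lmapDomain_apply]
      dsimp only
      split_ifs with h
      · subst h
        rw [Finsupp.mapDomain_apply e]
        exact Γ.components_eta_apply_mem a i
      · rw [Finsupp.mapDomain_of_notMem_range]
        · exact zero_mem _
        · rintro ⟨j, hj⟩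
          simp only [Prod.mk.injEq] at hj
          exact h (by rw [← hj.1, ← hj.2])
    · intro a
      rw [LinearMap.comp_apply, Finsupp.lmapDomain_apply, Finsupp.sum_mapDomain_index_inj e]
      exact Γ.components_eta_sum a
  mul_mem {p q a b} ha hb := by
    by_cases hab : a * b = 0
    · rw [hab]; exact zero_mem _
    split_ifs at ha with h₁
    · split_ifs at hb with h₂
      · rw [if_pos]
        · exact Γ.mul_mem ha hb
        · rw [Prod.fst_mul, Prod.snd_mul, hr _ _ a ha b hb hab, h₁, h₂]
      · exact absurd (by rw [(Submodule.mem_bot F).1 hb, mul_zero]) hab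
    · exact absurd (by rw [(Submodule.mem_bot F).1 ha, zero_mul]) hab

variable (Γ : Grading F I B) (r : I → K)
    (hr : ∀ i j, ∀ a ∈ Γ.comp i, ∀ b ∈ Γ.comp j, a * b ≠ 0 → r (i * j) = r i * r j)

lemma graph_comp (i : I) : (Γ.graph r hr).comp (i, r i) = Γ.comp i := if_pos rfl

lemma graph_comp_of_ne {i : I} {k : K} (h : k ≠ r i) : (Γ.graph r hr).comp (i, k) = ⊥ := if_neg h

end Regrade

section Proj

variable {U : Type u} [CommGroup U] {A : Type u} [NonUnitalNonAssocRing A] [Module F A]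
  {Γ : Grading F U A}

lemma proj_of_mem {g : U} {a : A} (ha : a ∈ Γ.comp g) : Γ.proj g a = a := by
  rw [proj, Γ.glue_apply _ ha, if_pos rfl, LinearMap.id_apply]

lemma proj_of_mem_of_ne {g h : U} {a : A} (ha : a ∈ Γ.comp h) (hne : h ≠ g) :
    Γ.proj g a = 0 := by
  rw [proj, Γ.glue_apply _ ha, if_neg hne, LinearMap.zero_apply]

lemma eq_of_mem_of_mem {g h : U} {a : A} (ha : a ∈ Γ.comp g) (ha' : a ∈ Γ.comp h) (h0 : a ≠ 0) :
    g = h := by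
  by_contra hne
  exact h0 (by rw [← proj_of_mem ha, proj_of_mem_of_ne ha' (Ne.symm hne)])

lemma proj_baseChange_mem (Γ : Grading F U A) {R : CommAlgCat.{u} F} (g : U) (x : R ⊗[F] A) :
    (Γ.proj g).baseChange R x ∈ (Γ.comp g).baseChange R := by
  induction x with
  | zero => rw [map_zero]; exact zero_mem _
  | add x y hx hy => rw [map_add]; exact add_mem hx hy
  | tmul r a =>
    rw [LinearMap.baseChange_tmul]
    refine Submodule.tmul_mem_baseChange_of_mem _ ?_
    induction a using Γ.hom_induction with
    | zero => simp
    | add x y hx hy => rw [map_add]; exact add_mem hx hy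
    | hom h a ha =>
      by_cases e : h = g
      · subst e; rwa [proj_of_mem ha]
      · rw [proj_of_mem_of_ne ha e]; exact zero_mem _

lemma proj_baseChange_of_mem {R : CommAlgCat.{u} F} {g : U} {x : R ⊗[F] A}
    (hx : x ∈ (Γ.comp g).baseChange R) : (Γ.proj g).baseChange R x = x := by
  rw [Submodule.baseChange_eq_span] at hx
  induction hx using Submodule.span_induction with
  | mem x h =>
    obtain ⟨w, hw, rfl⟩ := h
    rw [TensorProduct.mk_apply, LinearMap.baseChange_tmul, proj_of_mem hw]
  | zero => simp
  | add x y _ _ hx hy => rw [map_add, hx, hy]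
  | smul t x _ hx => rw [map_smul, hx]

lemma proj_baseChange_of_mem_of_ne {R : CommAlgCat.{u} F} {g h : U} {x : R ⊗[F] A}
    (hx : x ∈ (Γ.comp h).baseChange R) (hne : h ≠ g) : (Γ.proj g).baseChange R x = 0 := by
  rw [Submodule.baseChange_eq_span] at hx
  induction hx using Submodule.span_induction with
  | mem x h =>
    obtain ⟨w, hw, rfl⟩ := h
    rw [TensorProduct.mk_apply, LinearMap.baseChange_tmul, proj_of_mem_of_ne hw hne,
      TensorProduct.tmul_zero]
  | zero => simp
  | add x y _ _ hx hy => rw [map_add, hx, hy, add_zero]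
  | smul t x _ hx => rw [map_smul, hx, smul_zero]

lemma block_zero {R : CommAlgCat.{u} F} (W : Submodule F A) : block R W 0 = ⊥ := by
  rw [eq_bot_iff]
  rintro _ ⟨y, -, rfl⟩
  simp

lemma block_le {R : CommAlgCat.{u} F} (W : Submodule F A) (e : R) :
    block R W e ≤ W.baseChange R := by
  rintro _ ⟨y, hy, rfl⟩
  exact Submodule.smul_mem _ _ hy

/-- A refinement of a fine grading has the same nonzero components. -/
lemma IsFine.exists_comp_le (hf : Γ.IsFine) {H : Type u} [CommGroup H] (Δ : Grading F H A)
    (π : H → U) (hπ : ∀ k, Δ.comp k ≤ Γ.comp (π k)) (g : U) :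
    ∃ k, Γ.comp g ≤ Δ.comp k := by
  by_cases hg : ∀ k, π k = g → Δ.comp k = ⊥
  · refine ⟨1, fun a ha => ?_⟩
    have h0 : Γ.proj g = 0 := by
      ext a
      induction a using Δ.hom_induction with
      | hom k a ha =>
        by_cases hk : π k = g
        · rw [hg k hk, Submodule.mem_bot] at ha
          rw [ha, map_zero, map_zero]
        · exact proj_of_mem_of_ne (hπ k ha) hk
      | zero => rw [map_zero, map_zero]
      | add a b h h' => rw [map_add, map_add, h, h']
    rw [← proj_of_mem ha, h0]
    exact zero_mem _
  · push Not at hg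
    obtain ⟨k, rfl, hk⟩ := hg
    refine ⟨k, ?_⟩
    by_contra hle
    exact hf ⟨H, _, Δ, fun h _ => ⟨π h, hπ h⟩, k, π k, hk, lt_of_le_not_ge (hπ k) hle⟩

instance finite_supp [FiniteDimensional F A] : Finite Γ.supp := by
  classical
  exact (WellFoundedGT.finite_ne_bot_of_iSupIndep
    Γ.isInternal.submodule_iSupIndep).to_subtype

lemma sum_proj_baseChange [Fintype Γ.supp] {R : CommAlgCat.{u} F} (x : R ⊗[F] A) :
    ∑ s : Γ.supp, (Γ.proj s.1).baseChange R x = x := by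
  classical
  have h : (∑ s : Γ.supp, (Γ.proj s.1).baseChange R) = (1 : Module.End R (R ⊗[F] A)) := by
    refine Γ.end_ext_hom fun g a ha => ?_
    rw [LinearMap.sum_apply]
    by_cases hg : Γ.comp g = ⊥
    · rw [hg, Submodule.mem_bot] at ha
      simp [ha]
    · refine (Finset.sum_eq_single (⟨g, hg⟩ : Γ.supp) (fun s _ hs => ?_)
        fun h => absurd (Finset.mem_univ (α := Γ.supp) _) h).trans ?_
      · rw [LinearMap.baseChange_tmul, proj_of_mem_of_ne ha, TensorProduct.tmul_zero]
        rintro rfl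
        exact hs rfl
      · rw [LinearMap.baseChange_tmul, proj_of_mem ha, Module.End.one_apply]
  have := LinearMap.congr_fun h x
  rwa [LinearMap.sum_apply] at this

end Proj

section Fine

variable {U : Type u} [CommGroup U] {A : Type u} [NonUnitalNonAssocRing A] [Module F A]
  [IsScalarTower F A A] [SMulCommClass F A A] {Γ : Grading F U A}

lemma autEnd_one_tmul_mul {R : CommAlgCat.{u} F} (φ : (autScheme F A).obj R) (a b : A) :
    autEnd φ ((1 : R) ⊗ₜ (a * b)) = autEnd φ ((1 : R) ⊗ₜ a) * autEnd φ ((1 : R) ⊗ₜ b) := by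
  have h := φ.2 ((1 : R) ⊗ₜ a) ((1 : R) ⊗ₜ b)
  rw [Algebra.TensorProduct.tmul_mul_tmul, one_mul] at h
  exact h

lemma act_apply_of_mem (χ : U →* (R : CommAlgCat.{u} F)ˣ) {g : U} {x : R ⊗[F] A}
    (hx : x ∈ (Γ.comp g).baseChange R) : act Γ.eta χ x = (χ g : R) • x := by
  rw [Submodule.baseChange_eq_span] at hx
  induction hx using Submodule.span_induction with
  | mem x h =>
    obtain ⟨w, hw, rfl⟩ := h
    exact Γ.tau_one_tmul χ hw
  | zero => simp
  | add x y _ _ hx hy => rw [map_add, hx, hy, smul_add]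
  | smul t x _ hx => rw [map_smul, hx, smul_comm]

/-- Every point of `Diag(Γ)` is given by a character of `U`: the surjectivity half of the
universality of `Γ`. -/
def DiagLeEta (Γ : Grading F U A) : Prop :=
  ∀ (R : CommAlgCat.{u} F) (x : (autScheme F A).obj R), x ∈ Γ.diag.pts R →
    ∃ χ : U →* Rˣ, autEnd x = act Γ.eta χ

lemma IsUniversal.diagLeEta (h : Γ.IsUniversal) : DiagLeEta Γ := by
  obtain ⟨i, hi⟩ := h
  intro R x hx
  refine ⟨(i.inv.app R).hom ⟨x, hx⟩, ?_⟩
  have h1 : (Γ.eta.app R).hom ((i.inv.app R).hom ⟨x, hx⟩) = x := by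
    rw [← hi]
    have h2 := ConcreteCategory.congr_hom (i.inv_hom_id_app R) ⟨x, hx⟩
    exact congrArg Subtype.val h2
  exact congrArg autEnd h1.symm

/-- If every component of `Γ` lies in a component of `Δ`, the characters of `Δ` act through
`Diag(Γ)`. -/
lemma act_mem_diag {H : Type u} [CommGroup H] (Δ : Grading F H A)
    (h : ∀ g, ∃ k, Γ.comp g ≤ Δ.comp k) {R : CommAlgCat.{u} F} (χ : H →* Rˣ) :
    (Δ.eta.app R).hom χ ∈ Γ.diag.pts R := by
  intro g
  obtain ⟨k, hk⟩ := h g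
  exact ⟨χ k, fun x hx => act_apply_of_mem χ (Submodule.baseChange_mono _ hk hx)⟩

end Fine

section Transport

variable {A : Type u} [NonUnitalNonAssocRing A] [Module F A] [IsScalarTower F A A]
  [SMulCommClass F A A] {B : Type u} [NonUnitalNonAssocRing B] [Module F B]
  [IsScalarTower F B B] [SMulCommClass F B B] {φ : autScheme F A ≅ autScheme F B}
  {U : Type u} [CommGroup U] {Γ : Grading F U A} {Γ' : Grading F U B}

/-- Maximality of `Diag(Γ)` for a fine grading, read off on the other algebra: the characters of
a refinement of `Γ'` act through those of `U`. -/
lemma exists_act_eq_of_refinement (hf : Γ.IsFine) (hd : DiagLeEta Γ)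
    (hη : Γ'.eta = Γ.eta ≫ φ.hom) {H : Type u} [CommGroup H] (Δ : Grading F H B) (π : H →* U)
    (hπ : ∀ k, Δ.comp k ≤ Γ'.comp (π k)) {R : CommAlgCat.{u} F} (χ : H →* Rˣ) :
    ∃ χ' : U →* Rˣ, act Δ.eta χ = act Γ'.eta χ' := by
  let Δ' : Grading F H A := ofHom (Δ.eta ≫ φ.inv)
  have hΔ' : Δ'.eta = Δ.eta ≫ φ.inv := eta_ofHom _
  have hη' : Γ.eta = Γ'.eta ≫ φ.inv := by rw [hη, Category.assoc, φ.hom_inv_id, Category.comp_id]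
  have h1 : ∀ k, Δ'.comp k ≤ Γ.comp (π k) := by
    refine comp_le_of_act_eq Γ Δ' π fun R χ => ?_
    rw [hΔ', hη']
    have h := autEnd_ext (act_eq_of_comp_le Γ' Δ π hπ χ)
    exact congrArg (fun y => autEnd ((φ.inv.app R).hom y)) h
  obtain ⟨χ', h2⟩ := hd R _ (act_mem_diag Δ' (hf.exists_comp_le Δ' π h1) χ)
  refine ⟨χ', ?_⟩
  have h3 := autEnd_ext h2
  have hΔ : Δ.eta = Δ'.eta ≫ φ.hom := by
    rw [hΔ', Category.assoc, φ.inv_hom_id, Category.comp_id]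
  rw [hΔ, hη]
  exact congrArg (fun y => autEnd ((φ.hom.app R).hom y)) h3

/-- A point of `Diag(Γ')(R)` with scalars `r` is a character of the regrading by `U × Rˣ` along
`r`, which refines `Γ'`. -/
lemma DiagLeEta.transport (hf : Γ.IsFine) (hd : DiagLeEta Γ) (hη : Γ'.eta = Γ.eta ≫ φ.hom) :
    DiagLeEta Γ' := by
  intro R x hx
  choose r hr using hx
  have hmul : ∀ i j, ∀ a ∈ Γ'.comp i, ∀ b ∈ Γ'.comp j, a * b ≠ 0 → r (i * j) = r i * r j := by
    intro i j a ha b hb hab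
    refine Units.ext (tmul_right_injective (F := F) hab ?_)
    have h := autEnd_one_tmul_mul x a b
    rw [hr _ _ (Submodule.tmul_mem_baseChange_of_mem _ (Γ'.mul_mem ha hb)),
      hr _ _ (Submodule.tmul_mem_baseChange_of_mem _ ha),
      hr _ _ (Submodule.tmul_mem_baseChange_of_mem _ hb)] at h
    simpa [TensorProduct.smul_tmul'] using h
  have hπ : ∀ k, (Γ'.graph r hmul).comp k ≤ Γ'.comp (MonoidHom.fst U Rˣ k) := by
    rintro ⟨i, k⟩
    by_cases h : k = r i
    · subst h; exact (Γ'.graph_comp r hmul i).le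
    · rw [graph_comp_of_ne _ _ _ h]; exact bot_le
  obtain ⟨χ, hχ⟩ := exists_act_eq_of_refinement hf hd hη _ _ hπ (MonoidHom.snd U Rˣ)
  refine ⟨χ, hχ ▸ Γ'.end_ext_hom fun g a ha => ?_⟩
  rw [hr g _ (Submodule.tmul_mem_baseChange_of_mem _ ha), act_eta]
  rw [← Γ'.graph_comp r hmul] at ha
  exact (tau_one_tmul _ (MonoidHom.snd U Rˣ) ha).symm

/-- A refinement of `Γ'`, regraded along the map `r` to `U`, has its generic character acting
through `D(U)`, so by a scalar on each component of `Γ'`; this scalar tells the components of the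
refinement apart. -/
lemma IsFine.transport (hf : Γ.IsFine) (hd : DiagLeEta Γ) (hη : Γ'.eta = Γ.eta ≫ φ.hom) :
    Γ'.IsFine := by
  rintro ⟨H, _, Δ, hΔ, h₀, g₀, hne, hlt⟩
  have hex : ∀ h, ∃ g, Δ.comp h ≤ Γ'.comp g := fun h => by
    by_cases hh : Δ.comp h = ⊥
    · exact ⟨1, hh ▸ bot_le⟩
    · exact hΔ h hh
  choose r hr using hex
  have hmul : ∀ i j, ∀ a ∈ Δ.comp i, ∀ b ∈ Δ.comp j, a * b ≠ 0 → r (i * j) = r i * r j :=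
    fun i j a ha b hb hab => eq_of_mem_of_mem (hr _ (Δ.mul_mem ha hb))
      (Γ'.mul_mem (hr i ha) (hr j hb)) hab
  have hπ : ∀ k, (Δ.graph r hmul).comp k ≤ Γ'.comp (MonoidHom.snd H U k) := by
    rintro ⟨i, k⟩
    by_cases h : k = r i
    · subst h; exact (Δ.graph_comp r hmul i).le.trans (hr i)
    · rw [graph_comp_of_ne _ _ _ h]; exact bot_le
  obtain ⟨χ, hχ⟩ := exists_act_eq_of_refinement hf hd hη _ _ hπ
    (R := groupAlg F F (H × U)) (genericChar F (H × U))
  obtain ⟨a, ha, ha0⟩ := (Submodule.ne_bot_iff _).1 hne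
  obtain rfl : r h₀ = g₀ := eq_of_mem_of_mem (hr h₀ ha) (hlt.le ha) ha0
  have ha' := ha
  rw [← Δ.graph_comp r hmul, mem_comp_iff, coaction_apply, hχ] at ha'
  -- the scalar by which the generic character acts on `Γ'_{r h₀}` can be read off at `a`
  have hv : (χ (r h₀) : MonoidAlgebra F (H × U)) = MonoidAlgebra.single (h₀, r h₀) 1 := by
    refine tmul_right_injective (F := F) ha0 (Eq.trans ?_ ha')
    refine Eq.trans ?_ (Γ'.tau_one_tmul (R := groupAlg F F (H × U)) χ (hlt.le ha)).symm
    rw [TensorProduct.smul_tmul', smul_eq_mul, mul_one]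
  refine hlt.not_ge fun b hb => ?_
  rw [← Δ.graph_comp r hmul, mem_comp_iff, coaction_apply, hχ]
  refine (Γ'.tau_one_tmul (R := groupAlg F F (H × U)) χ hb).trans ?_
  rw [TensorProduct.smul_tmul', smul_eq_mul, mul_one, hv]

end Transport

end Grading
end
end GradingScheme

/-! ### Stabilizers as centralizers, automorphism group schemes as normalizers -/

namespace GradingScheme
noncomputable section
variable {F : Type u} [Field F]

section Coefficients

variable {R : CommAlgCat.{u} F} {U : Type u} [CommGroup U] {V : Type u} [AddCommGroup V]
  [Module F V]

variable (R U) in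
/-- The inclusion `R → R[U]`. -/
def toGroupAlg : R ⟶ groupAlg F R U := CommAlgCat.ofHom MonoidAlgebra.singleOneAlgHom

variable (V) in
/-- The coefficient at `u` of an element of `R[U] ⊗ V`. -/
def coeffAt (R : CommAlgCat.{u} F) (u : U) : (MonoidAlgebra R U ⊗[F] V) →ₗ[F] (R ⊗[F] V) :=
  (Finsupp.lapply u ∘ₗ (MonoidAlgebra.coeffLinearEquiv F).toLinearMap :
    MonoidAlgebra R U →ₗ[F] R).rTensor V

lemma coeffAt_smul_base (u : U) (s : MonoidAlgebra R U) (x : R ⊗[F] V) :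
    coeffAt V R u (s • (base V (toGroupAlg R U) x : MonoidAlgebra R U ⊗[F] V)) =
      s.coeff u • x := by
  induction x with
  | zero => simp
  | add x y hx hy =>
    rw [map_add, smul_add, smul_add, map_add, ← hx, ← hy]
  | tmul r v =>
    have : (s • (base V (toGroupAlg R U) (r ⊗ₜ[F] v) : MonoidAlgebra R U ⊗[F] V)) =
      (s * MonoidAlgebra.single 1 r) ⊗ₜ[F] v := rfl
    rw [this, coeffAt, LinearMap.rTensor_tmul, TensorProduct.smul_tmul']
    congr 1
    simp

end Coefficients

namespace Grading

variable {U : Type u} [CommGroup U] {A : Type u} [NonUnitalNonAssocRing A] [Module F A]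
  [IsScalarTower F A A] [SMulCommClass F A A] (Γ : Grading F U A)

lemma coeffAt_act_generic {R : CommAlgCat.{u} F} (u : U) (x : R ⊗[F] A) :
    coeffAt A R u (act Γ.eta (R := groupAlg F R U) (genericChar R U)
      (base A (toGroupAlg R U) x)) = (Γ.proj u).baseChange R x := by
  classical
  induction x with
  | zero => simp
  | add x y hx hy => simp only [map_add, hx, hy]
  | tmul r a =>
    induction a using Γ.hom_induction with
    | zero => simp
    | add x y hx hy => simp only [TensorProduct.tmul_add, map_add, hx, hy]
    | hom g a ha =>
      rw [act_apply_of_mem (g := g)]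
      · refine (coeffAt_smul_base u _ (r ⊗ₜ[F] a)).trans ?_
        rw [genericChar_val, MonoidAlgebra.coeff_single, LinearMap.baseChange_tmul,
          Finsupp.single_apply]
        split_ifs with h
        · subst h
          rw [proj_of_mem ha, one_smul]
        · rw [proj_of_mem_of_ne ha h, zero_smul, TensorProduct.tmul_zero]
      · rw [LinearMap.rTensor_tmul]
        exact Submodule.tmul_mem_baseChange_of_mem _ ha

/-- If conjugation by `x` carries some character `χ` of `R[U]` to the generic one, then on the
image under `x` of the component of degree `g` the projections onto the components are
scalars: the coefficients of `χ g`. -/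
lemma proj_apply_of_conj {R : CommAlgCat.{u} F} {x : (autScheme F A).obj R}
    {χ : U →* (groupAlg F R U)ˣ}
    (h : act Γ.eta (R := groupAlg F R U) (genericChar R U) * extend (toGroupAlg R U) (autEnd x) =
      extend (toGroupAlg R U) (autEnd x) * act Γ.eta χ)
    {g : U} {y : R ⊗[F] A} (hy : y ∈ (Γ.comp g).baseChange R) (u : U) :
    (Γ.proj u).baseChange R (autEnd x y) =
      (χ g : MonoidAlgebra R U).coeff u • autEnd x y := by
  rw [← coeffAt_act_generic, ← extend_base, ← Module.End.mul_apply, h, Module.End.mul_apply,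
    act_apply_of_mem (g := g), map_smul, extend_base]
  · exact coeffAt_smul_base u _ _
  · rw [Submodule.baseChange_eq_span] at hy
    induction hy using Submodule.span_induction with
    | mem x h =>
      obtain ⟨w, hw, rfl⟩ := h
      rw [TensorProduct.mk_apply, base_one]
      exact Submodule.tmul_mem_baseChange_of_mem _ hw
    | zero => simp
    | add x y _ _ hx hy => rw [map_add]; exact add_mem hx hy
    | smul r x _ hx => rw [base_smul]; exact Submodule.smul_mem _ _ hx

end Grading

/-! ### Centralizers and normalizers -/

section Functorial

variable {D G G' : GroupFunctor F}

/-- `x ∈ G(R)` centralizes the image of `f`, over every extension of `R`. -/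
def Centralizes (f : D ⟶ G) {R : CommAlgCat.{u} F} (x : G.obj R) : Prop :=
  ∀ (S : CommAlgCat.{u} F) (ι : R ⟶ S) (d : D.obj S),
    (G.map ι).hom x * (f.app S).hom d = (f.app S).hom d * (G.map ι).hom x

/-- `x ∈ G(R)` normalizes the image of `f`, over every extension of `R`. -/
def Normalizes (f : D ⟶ G) {R : CommAlgCat.{u} F} (x : G.obj R) : Prop :=
  ∀ (S : CommAlgCat.{u} F) (ι : R ⟶ S) (d : D.obj S),
    (∃ d', (f.app S).hom d * (G.map ι).hom x = (G.map ι).hom x * (f.app S).hom d') ∧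
    (∃ d', (f.app S).hom d * (G.map ι).hom x⁻¹ = (G.map ι).hom x⁻¹ * (f.app S).hom d')

lemma Centralizes.map {f : D ⟶ G} {R : CommAlgCat.{u} F} {x : G.obj R} (h : Centralizes f x)
    (φ : G ⟶ G') : Centralizes (f ≫ φ) ((φ.app R).hom x) := by
  intro S ι d
  have e := ConcreteCategory.congr_hom (φ.naturality ι) x
  have h1 := congrArg (φ.app S).hom (h S ι d)
  rw [map_mul, map_mul] at h1
  refine Eq.trans ?_ (h1.trans ?_)
  · exact congrArg (· * _) e.symm
  · exact congrArg (_ * ·) e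

lemma Normalizes.map {f : D ⟶ G} {R : CommAlgCat.{u} F} {x : G.obj R} (h : Normalizes f x)
    (φ : G ⟶ G') : Normalizes (f ≫ φ) ((φ.app R).hom x) := by
  intro S ι d
  have key : ∀ y : G.obj R,
      (∃ d', (f.app S).hom d * (G.map ι).hom y = (G.map ι).hom y * (f.app S).hom d') →
      ∃ d', ((f ≫ φ).app S).hom d * (G'.map ι).hom ((φ.app R).hom y) =
        (G'.map ι).hom ((φ.app R).hom y) * ((f ≫ φ).app S).hom d' := by
    rintro y ⟨d', hd'⟩
    refine ⟨d', ?_⟩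
    have e := ConcreteCategory.congr_hom (φ.naturality ι) y
    have h1 := congrArg (φ.app S).hom hd'
    rw [map_mul, map_mul] at h1
    refine Eq.trans ?_ (h1.trans ?_)
    · exact congrArg (_ * ·) e.symm
    · exact congrArg (· * _) e
  refine ⟨key _ (h S ι d).1, ?_⟩
  rw [← map_inv]
  exact key _ (h S ι d).2

lemma centralizes_map_iff {f : D ⟶ G} (φ : G ≅ G') {R : CommAlgCat.{u} F} {x : G.obj R} :
    Centralizes (f ≫ φ.hom) ((φ.hom.app R).hom x) ↔ Centralizes f x := by
  refine ⟨fun h => ?_, fun h => h.map _⟩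
  have h1 := h.map φ.inv
  rw [Category.assoc, φ.hom_inv_id, Category.comp_id] at h1
  have h2 := ConcreteCategory.congr_hom (φ.hom_inv_id_app R) x
  rwa [show (φ.inv.app R).hom ((φ.hom.app R).hom x) = x from h2] at h1

lemma normalizes_map_iff {f : D ⟶ G} (φ : G ≅ G') {R : CommAlgCat.{u} F} {x : G.obj R} :
    Normalizes (f ≫ φ.hom) ((φ.hom.app R).hom x) ↔ Normalizes f x := by
  refine ⟨fun h => ?_, fun h => h.map _⟩
  have h1 := h.map φ.inv
  rw [Category.assoc, φ.hom_inv_id, Category.comp_id] at h1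
  have h2 := ConcreteCategory.congr_hom (φ.hom_inv_id_app R) x
  rwa [show (φ.inv.app R).hom ((φ.hom.app R).hom x) = x from h2] at h1

end Functorial

namespace Grading

variable {U : Type u} [CommGroup U] {A : Type u} [NonUnitalNonAssocRing A] [Module F A]
  [IsScalarTower F A A] [SMulCommClass F A A] (Γ : Grading F U A)

lemma autEnd_apply_inv {R : CommAlgCat.{u} F} (x : (autScheme F A).obj R) (y : R ⊗[F] A) :
    autEnd x (autEnd x⁻¹ y) = y := by
  conv_lhs => rw [← inv_inv x, inv_inv x⁻¹]
  exact autEnd_inv_apply x⁻¹ y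

/-- `Stab(Γ)` is the centralizer of the image of `η_Γ`. -/
lemma mem_stab_iff {R : CommAlgCat.{u} F} {x : (autScheme F A).obj R} :
    x ∈ Γ.stab.pts R ↔ Centralizes Γ.eta x := by
  constructor
  · intro hx S ι χ
    have hS := Γ.stab.map_mem ι x hx
    refine autEnd_ext (Γ.end_ext_hom fun g a ha => ?_)
    have ha' := Submodule.tmul_mem_baseChange_of_mem (A := S) (p := Γ.comp g) 1 ha
    have hm : autEnd (((autScheme F A).map ι).hom x) (1 ⊗ₜ a) ∈ (Γ.comp g).baseChange S := by
      rw [← hS g]; exact ⟨_, ha', rfl⟩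
    rw [autEnd_mul, autEnd_mul, Module.End.mul_apply, Module.End.mul_apply]
    refine Eq.trans (congrArg _ (act_apply_of_mem χ ha')) ?_
    rw [map_smul]
    exact (act_apply_of_mem χ hm).symm
  · intro hx
    have key : ∀ x : (autScheme F A).obj R, Centralizes Γ.eta x → ∀ g,
        ∀ y ∈ (Γ.comp g).baseChange R, autEnd x y ∈ (Γ.comp g).baseChange R := by
      intro x hx g y hy
      have h := congrArg autEnd (hx _ (toGroupAlg R U) (genericChar R U)).symm
      have h1 := Γ.proj_apply_of_conj h hy g
      have h2 : ((genericChar R U g : MonoidAlgebra R U)).coeff g = 1 := by simp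
      rw [h2, one_smul] at h1
      rw [← h1]
      exact Γ.proj_baseChange_mem g _
    have hx' : Centralizes Γ.eta x⁻¹ := by
      intro S ι d
      rw [map_inv]
      have := hx S ι d
      rw [inv_mul_eq_iff_eq_mul, ← mul_assoc, this, mul_inv_cancel_right]
    intro g
    refine le_antisymm ?_ fun y hy => ⟨autEnd x⁻¹ y, key _ hx' g y hy, autEnd_apply_inv x y⟩
    rintro _ ⟨y, hy, rfl⟩
    exact key _ hx g y hy

/-- An automorphism which, with its inverse, spreads each homogeneous component over the others
by scalars `c`, permutes the components locally: for each `g` the `c g u` are complete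
orthogonal idempotents, and so are the `c g u` for each `u`, being the scalars of the inverse;
the product of the `c g (f g)` over all `g` vanishes unless the map `f` is a bijection. -/
lemma permutesLocally_of_proj_apply [FiniteDimensional F A] {R : CommAlgCat.{u} F}
    {x : (autScheme F A).obj R} (c d : Γ.supp → Γ.supp → R)
    (hc : ∀ g u, ∀ y ∈ (Γ.nzComp g).baseChange R,
      (Γ.proj u.1).baseChange R (autEnd x y) = c g u • autEnd x y)
    (hd : ∀ g u, ∀ y ∈ (Γ.nzComp g).baseChange R,
      (Γ.proj u.1).baseChange R (autEnd x⁻¹ y) = d g u • autEnd x⁻¹ y) :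
    PermutesLocally Γ.nzComp (autEnd x) := by
  classical
  have := Fintype.ofFinite Γ.supp
  have cancel : ∀ (x : (autScheme F A).obj R) (g : Γ.supp) (r t : R),
      (∀ y ∈ (Γ.nzComp g).baseChange R, r • autEnd x y = t • autEnd x y) → r = t := by
    intro x g r t h
    obtain ⟨a, ha, ha0⟩ := (Submodule.ne_bot_iff _).1 g.2
    have h1 := congrArg (autEnd x⁻¹) (h _ (Submodule.tmul_mem_baseChange_of_mem 1 ha))
    rw [map_smul, map_smul, autEnd_inv_apply, TensorProduct.smul_tmul', TensorProduct.smul_tmul',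
      smul_eq_mul, smul_eq_mul, mul_one, mul_one] at h1
    exact tmul_right_injective ha0 h1
  have complete : ∀ (x : (autScheme F A).obj R) (c : Γ.supp → Γ.supp → R),
      (∀ g u, ∀ y ∈ (Γ.nzComp g).baseChange R,
        (Γ.proj u.1).baseChange R (autEnd x y) = c g u • autEnd x y) →
      ∀ g, CompleteOrthogonalIdempotents (c g) := by
    intro x c hc g
    refine ⟨⟨fun u => ?_, fun u v huv => ?_⟩, ?_⟩
    · refine cancel x g _ _ fun y hy => ?_
      have h1 := proj_baseChange_of_mem (Γ.proj_baseChange_mem u.1 (autEnd x y))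
      rwa [hc g u y hy, map_smul, hc g u y hy, smul_smul] at h1
    · refine cancel x g _ _ fun y hy => ?_
      have h1 := proj_baseChange_of_mem_of_ne (Γ.proj_baseChange_mem v.1 (autEnd x y))
        (g := u.1) (fun h => huv (Subtype.ext h.symm))
      rw [hc g v y hy, map_smul, hc g u y hy, smul_smul] at h1
      rw [mul_comm, h1, zero_smul]
    · refine cancel x g _ _ fun y hy => ?_
      rw [Finset.sum_smul, one_smul]
      simp only [← hc g _ y hy]
      exact Γ.sum_proj_baseChange _
  have hC := complete x c hc
  have hD := complete x⁻¹ d hd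
  -- where `x` moves degree `g` to degree `u`, its inverse moves `u` back to `g`
  have swap : ∀ (x : (autScheme F A).obj R) (c d : Γ.supp → Γ.supp → R),
      (∀ g u, ∀ y ∈ (Γ.nzComp g).baseChange R,
        (Γ.proj u.1).baseChange R (autEnd x y) = c g u • autEnd x y) →
      (∀ g u, ∀ y ∈ (Γ.nzComp g).baseChange R,
        (Γ.proj u.1).baseChange R (autEnd x⁻¹ y) = d g u • autEnd x⁻¹ y) →
      ∀ g u, c g u = d u g * c g u := by
    intro x c d hc hd g u
    obtain ⟨a, ha, ha0⟩ := (Submodule.ne_bot_iff _).1 g.2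
    have ha' := Submodule.tmul_mem_baseChange_of_mem (A := R) (p := Γ.nzComp g) 1 ha
    have h1 : c g u • autEnd x (1 ⊗ₜ a) ∈ (Γ.nzComp u).baseChange R := by
      rw [← hc g u _ ha']; exact Γ.proj_baseChange_mem _ _
    have h2 := hd u g _ h1
    rw [map_smul, autEnd_inv_apply, proj_baseChange_of_mem (Submodule.smul_mem _ _ ha'),
      TensorProduct.smul_tmul', TensorProduct.smul_tmul', smul_eq_mul, smul_eq_mul, mul_one] at h2
    exact tmul_right_injective ha0 h2
  have hcd : ∀ g u, c g u = d u g := fun g u => by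
    have h := swap x⁻¹ d c hd (by rwa [inv_inv]) u g
    rw [h, mul_comm, ← swap x c d hc hd g u]
  -- `e f` is supported where `x` moves the component of each degree `g` to that of degree `f g`
  let e : (Γ.supp → Γ.supp) → R := fun f => ∏ g, c g (f g)
  have he : CompleteOrthogonalIdempotents e := by
    refine ⟨⟨fun f => ?_, fun f f' hff' => ?_⟩, ?_⟩
    · change (∏ g, c g (f g)) * (∏ g, c g (f g)) = _
      rw [← Finset.prod_mul_distrib]
      exact Finset.prod_congr rfl fun g _ => (hC g).idem (f g)
    · obtain ⟨g, hg⟩ := Function.ne_iff.1 hff'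
      change (∏ g, c g (f g)) * (∏ g, c g (f' g)) = 0
      rw [← Finset.prod_mul_distrib]
      exact Finset.prod_eq_zero (Finset.mem_univ g) ((hC g).ortho hg)
    · rw [← Fintype.prod_sum]
      exact Finset.prod_eq_one fun g _ => (hC g).complete
  have hdvd : ∀ f g, e f = e f * c g (f g) := fun f g => by
    change ∏ g, c g (f g) = (∏ g, c g (f g)) * _
    rw [← Finset.mul_prod_erase _ _ (Finset.mem_univ g), mul_comm, mul_assoc,
      (hC g).idem (f g)]
  have hbij : ∀ f, ¬ Function.Bijective f → e f = 0 := by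
    intro f hf
    rw [← Finite.injective_iff_bijective] at hf
    rw [Function.not_injective_iff] at hf
    obtain ⟨g, h, hgh, hne⟩ := hf
    rw [hdvd f g, hdvd f h, mul_assoc, hcd h, hcd g, ← hgh, (hD (f g)).ortho hne.symm, mul_zero]
  refine .of_fintype e (fun f => if h : Function.Bijective f then Equiv.ofBijective f h else 1)
    he fun f => ?_
  by_cases hf : Function.Bijective f
  · rw [dif_pos hf]
    intro s
    rw [Equiv.ofBijective_apply]
    apply le_antisymm
    · rintro _ ⟨_, ⟨y, hy, rfl⟩, rfl⟩
      refine ⟨(Γ.proj (f s).1).baseChange R (autEnd x y), Γ.proj_baseChange_mem _ _, ?_⟩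
      rw [hc s (f s) y hy, LinearMap.lsmul_apply, LinearMap.lsmul_apply, smul_smul, ← hdvd,
        map_smul]
    · rintro _ ⟨y, hy, rfl⟩
      refine ⟨e f • autEnd x⁻¹ y, ?_, ?_⟩
      · refine ⟨(Γ.proj s.1).baseChange R (autEnd x⁻¹ y), Γ.proj_baseChange_mem _ _, ?_⟩
        rw [hd (f s) s y hy, LinearMap.lsmul_apply, smul_smul, ← hcd, ← hdvd]
      · rw [map_smul, autEnd_apply_inv, LinearMap.lsmul_apply]
  · intro s
    rw [hbij f hf, block_zero, block_zero, Submodule.map_bot]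

/-- Conjugation by a point of `Aut(Γ)` preserves `Diag(Γ)`. -/
lemma conj_mem_diag {R : CommAlgCat.{u} F} {x τ : (autScheme F A).obj R}
    (hx : x ∈ Γ.aut.pts R) (hτ : τ ∈ Γ.diag.pts R) : x * τ * x⁻¹ ∈ Γ.diag.pts R := by
  choose r hr using hτ
  obtain ⟨n, e, σ, -, he, hσ⟩ : PermutesLocally Γ.nzComp (autEnd x) := hx
  -- the conjugate acts on the component of degree `u` by the scalar `∑ e_i r(σ_i⁻¹ u)`
  have hsum : ∀ t t' : Fin n → Rˣ, (∑ i, e i * (t i : R)) * (∑ i, e i * (t' i : R)) =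
      ∑ i, e i * ((t i * t' i : Rˣ) : R) := by
    classical
    intro t t'
    rw [Finset.sum_mul_sum]
    refine Finset.sum_congr rfl fun i _ => ?_
    rw [Finset.sum_eq_single i]
    · rw [mul_mul_mul_comm, he.idem i, Units.val_mul]
    · intro j _ hj
      rw [mul_mul_mul_comm, show e i * e j = 0 from he.ortho hj.symm, zero_mul]
    · simp
  intro u
  by_cases hu : Γ.comp u = ⊥
  · refine ⟨1, fun y hy => ?_⟩
    rw [hu, Submodule.baseChange_bot, Submodule.mem_bot] at hy
    rw [hy, map_zero, smul_zero]
  let v : Γ.supp := ⟨u, hu⟩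
  let t : Fin n → Rˣ := fun i => r ((σ i)⁻¹ v).1
  have hone : (∑ i, e i * ((1 : Rˣ) : R)) = 1 := by
    simp only [Units.val_one, mul_one]; exact he.complete
  refine ⟨⟨∑ i, e i * (t i : R), ∑ i, e i * ((t i)⁻¹ : Rˣ), ?_, ?_⟩, fun y hy => ?_⟩
  · rw [hsum t fun i => (t i)⁻¹]; simpa only [mul_inv_cancel] using hone
  · rw [hsum (fun i => (t i)⁻¹) t]; simpa only [inv_mul_cancel] using hone
  have hi : ∀ i, autEnd (x * τ * x⁻¹) (e i • y) = (e i * (t i : R)) • y := by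
    intro i
    have hmem : autEnd x⁻¹ (e i • y) ∈ (Γ.comp ((σ i)⁻¹ v).1).baseChange R := by
      have h := (PermutesBy.inv (φ := ((autSub F A).incl.app R).hom x) (hσ i)) v
      exact block_le _ (e i) (h.le ⟨e i • y, ⟨y, hy, rfl⟩, rfl⟩)
    rw [autEnd_mul, autEnd_mul, Module.End.mul_apply, Module.End.mul_apply, hr _ _ hmem, map_smul,
      autEnd_apply_inv, smul_smul, mul_comm]
  calc autEnd (x * τ * x⁻¹) y = autEnd (x * τ * x⁻¹) (∑ i, e i • y) := by
        rw [← Finset.sum_smul, he.complete, one_smul]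
    _ = (∑ i, e i * (t i : R)) • y := by
        rw [map_sum, Finset.sum_smul]
        exact Finset.sum_congr rfl fun i _ => hi i

/-- `Aut(Γ)` is the normalizer of the image of `η_Γ`, if this image is `Diag(Γ)`. -/
lemma mem_aut_iff [FiniteDimensional F A] (hΓ : DiagLeEta Γ) {R : CommAlgCat.{u} F}
    {x : (autScheme F A).obj R} : x ∈ Γ.aut.pts R ↔ Normalizes Γ.eta x := by
  constructor
  · have key : ∀ (S : CommAlgCat.{u} F) (z : (autScheme F A).obj S), z ∈ Γ.aut.pts S →
        ∀ χ : U →* Sˣ, ∃ χ' : U →* Sˣ,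
          (Γ.eta.app S).hom χ * z = z * (Γ.eta.app S).hom χ' := by
      intro S z hz χ
      have h1 : (Γ.eta.app S).hom χ ∈ Γ.diag.pts S :=
        act_mem_diag Γ (fun g => ⟨g, le_rfl⟩) χ
      obtain ⟨χ', h⟩ := hΓ S _ (Γ.conj_mem_diag (inv_mem hz) h1)
      refine ⟨χ', ?_⟩
      have h' := autEnd_ext h
      rw [inv_inv] at h'
      refine Eq.trans ?_ (congrArg (z * ·) h')
      simp [mul_assoc]
    intro hx S ι χ
    exact ⟨key S _ (Γ.aut.map_mem ι x hx) χ, key S _ (Γ.aut.map_mem ι x⁻¹ (inv_mem hx)) χ⟩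
  · intro hx
    obtain ⟨⟨χ₁, h₁⟩, ⟨χ₂, h₂⟩⟩ := hx _ (toGroupAlg R U) (genericChar R U)
    exact Γ.permutesLocally_of_proj_apply _ _
      (fun g u y hy => Γ.proj_apply_of_conj (congrArg autEnd h₁) hy u.1)
      (fun g u y hy => Γ.proj_apply_of_conj (congrArg autEnd h₂) hy u.1)

end Grading
end
end GradingScheme

/-! ### Images of morphisms to constant group schemes -/

namespace GradingScheme
noncomputable section
variable {F : Type u} [Field F]

section Const

variable {H : Type u} [Group H] {G : GroupFunctor F}

/-- The value at a prime of a point of a constant group scheme. -/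
def valueAt {R : CommAlgCat.{u} F} (c : (constScheme F H).obj R) (p : PrimeSpectrum R) : H :=
  DFunLike.coe (F := LocallyConstant (PrimeSpectrum R) H) c p

lemma const_ext {R : CommAlgCat.{u} F} {c c' : (constScheme F H).obj R}
    (h : ∀ p, valueAt c p = valueAt c' p) : c = c' :=
  LocallyConstant.ext h

lemma valueAt_mul {R : CommAlgCat.{u} F} (c c' : (constScheme F H).obj R) (p : PrimeSpectrum R) :
    valueAt (c * c') p = valueAt c p * valueAt c' p := rfl

lemma valueAt_one {R : CommAlgCat.{u} F} (p : PrimeSpectrum R) :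
    valueAt (1 : (constScheme F H).obj R) p = 1 := rfl

lemma valueAt_inv {R : CommAlgCat.{u} F} (c : (constScheme F H).obj R) (p : PrimeSpectrum R) :
    valueAt c⁻¹ p = (valueAt c p)⁻¹ := rfl

lemma valueAt_map {R S : CommAlgCat.{u} F} (ι : R ⟶ S) (c : (constScheme F H).obj R)
    (p : PrimeSpectrum S) : valueAt (((constScheme F H).map ι).hom c) p =
      valueAt c (PrimeSpectrum.comap ι.hom.toRingHom p) := rfl

lemma valueAt_app_map (f : G ⟶ constScheme F H) {R S : CommAlgCat.{u} F} (ι : R ⟶ S)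
    (g : G.obj R) (p : PrimeSpectrum S) :
    valueAt ((f.app S).hom ((G.map ι).hom g)) p =
      valueAt ((f.app R).hom g) (PrimeSpectrum.comap ι.hom.toRingHom p) := by
  rw [← valueAt_map]
  exact congrArg (valueAt · p) (ConcreteCategory.congr_hom (f.naturality ι) g)

/-- The elements of `H` which occur as constant values of `f` over some nonzero algebra. Over
the zero algebra the spectrum is empty and every element would occur. -/
def realized (f : G ⟶ constScheme F H) : Subgroup H where
  carrier := {σ | ∃ S : CommAlgCat.{u} F, Nontrivial S ∧ ∃ g : G.obj S,
    ∀ p, valueAt ((f.app S).hom g) p = σ}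
  one_mem' := ⟨CommAlgCat.of F F, inferInstanceAs (Nontrivial F), 1, fun p => by
    rw [map_one, valueAt_one]⟩
  inv_mem' := by
    rintro σ ⟨S, hS, g, hg⟩
    exact ⟨S, hS, g⁻¹, fun p => by rw [map_inv, valueAt_inv, hg]⟩
  mul_mem' := by
    rintro σ τ ⟨S, hS, g, hg⟩ ⟨T, hT, k, hk⟩
    -- both elements are realized over `S ⊗ T`
    let i : S ⟶ CommAlgCat.of F (S ⊗[F] T) :=
      CommAlgCat.ofHom Algebra.TensorProduct.includeLeft
    let j : T ⟶ CommAlgCat.of F (S ⊗[F] T) :=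
      CommAlgCat.ofHom Algebra.TensorProduct.includeRight
    refine ⟨CommAlgCat.of F (S ⊗[F] T), inferInstanceAs (Nontrivial (S ⊗[F] T)),
      (G.map i).hom g * (G.map j).hom k, fun p => ?_⟩
    rw [map_mul, valueAt_mul, valueAt_app_map, valueAt_app_map, hg, hk]

/-- Any value at a point is realized: pass to the residue field. -/
lemma valueAt_mem_realized (f : G ⟶ constScheme F H) {R : CommAlgCat.{u} F} (g : G.obj R)
    (p : PrimeSpectrum R) : valueAt ((f.app R).hom g) p ∈ realized f := by
  let i : R ⟶ CommAlgCat.of F p.asIdeal.ResidueField :=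
    CommAlgCat.ofHom (IsScalarTower.toAlgHom F R _)
  refine ⟨_, inferInstanceAs (Nontrivial p.asIdeal.ResidueField), (G.map i).hom g, fun q => ?_⟩
  rw [valueAt_app_map]
  congr 1
  ext1
  have hq : q.asIdeal = ⊥ :=
    (Ideal.eq_bot_or_top (K := p.asIdeal.ResidueField) q.asIdeal).resolve_right q.isPrime.ne_top
  rw [PrimeSpectrum.comap_asIdeal, hq]
  exact p.asIdeal.ker_algebraMap_residueField

/-- The constant group scheme of a subgroup of `H`: the locally constant functions with values
in this subgroup. -/
def constSub (N : Subgroup H) : SubgroupFunctor (constScheme F H) where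
  pts _ :=
    { carrier := {c | ∀ p, valueAt c p ∈ N}
      mul_mem' := fun hc hc' p => N.mul_mem (hc p) (hc' p)
      one_mem' := fun _ => N.one_mem
      inv_mem' := fun hc p => N.inv_mem (hc p) }
  map_mem _ _ hc _ := hc _

lemma isClopen_fiber {R : CommAlgCat.{u} F} (c : (constScheme F H).obj R) (σ : H) :
    IsClopen {p | valueAt c p = σ} :=
  (LocallyConstant.isLocallyConstant (X := PrimeSpectrum R) (Y := H) c).isClopen_fiber σ

/-- The idempotent supported where the locally constant function `c` takes the value `σ`. -/
def fiberIdem {R : CommAlgCat.{u} F} (c : (constScheme F H).obj R) (σ : H) : R :=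
  (PrimeSpectrum.exists_idempotent_basicOpen_eq_of_isClopen (isClopen_fiber c σ)).choose

lemma fiberIdem_spec {R : CommAlgCat.{u} F} (c : (constScheme F H).obj R) (σ : H) :
    IsIdempotentElem (fiberIdem c σ) ∧
      {p | valueAt c p = σ} = PrimeSpectrum.basicOpen (fiberIdem c σ) :=
  (PrimeSpectrum.exists_idempotent_basicOpen_eq_of_isClopen (isClopen_fiber c σ)).choose_spec

lemma eq_fiberIdem {R : CommAlgCat.{u} F} {c : (constScheme F H).obj R} {σ : H} {e : R}
    (he : IsIdempotentElem e) (h : ∀ p : PrimeSpectrum R, e ∉ p.asIdeal ↔ valueAt c p = σ) :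
    fiberIdem c σ = e := by
  refine PrimeSpectrum.basicOpen_injOn_isIdempotentElem (fiberIdem_spec c σ).1 he ?_
  refine SetLike.ext' ?_
  rw [← (fiberIdem_spec c σ).2]
  ext p
  exact (h p).symm

lemma fiberIdem_notMem {R : CommAlgCat.{u} F} (c : (constScheme F H).obj R) (σ : H)
    (p : PrimeSpectrum R) : fiberIdem c σ ∉ p.asIdeal ↔ valueAt c p = σ :=
  (Set.ext_iff.1 (fiberIdem_spec c σ).2 p).symm

lemma fiberIdem_map {R S : CommAlgCat.{u} F} (ι : R ⟶ S) (c : (constScheme F H).obj R) (σ : H) :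
    fiberIdem (((constScheme F H).map ι).hom c) σ = ι.hom (fiberIdem c σ) :=
  eq_fiberIdem ((fiberIdem_spec c σ).1.map ι.hom) fun p => by
    rw [valueAt_map, ← fiberIdem_notMem]
    rfl

variable (F) in
/-- The regular function on the constant group scheme of `H` that is `1` at `σ` and `0`
elsewhere. -/
def indicator (σ : H) : (constScheme F H ⋙ forget GrpCat.{u}) ⟶ forget (CommAlgCat.{u} F) where
  app R := ↾ fun c : (constScheme F H).obj R => fiberIdem c σ
  naturality R S ι := by
    ext c
    exact fiberIdem_map ι c σ

/-- The subgroup is cut out by the indicator functions of the elements outside it. -/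
lemma isClosed_constSub (N : Subgroup H) : (constSub (F := F) N).IsClosed := by
  intro R c hc p
  by_contra hp
  have h := hc (indicator F (valueAt c p)) fun S k hk =>
    eq_fiberIdem (IsIdempotentElem.zero) fun q =>
      ⟨fun h => absurd (zero_mem _) h, fun h => absurd (hk q) (h ▸ hp)⟩
  refine (fiberIdem_notMem c (valueAt c p) p).2 rfl ?_
  have h' : fiberIdem c (valueAt c p) = 0 := h
  rw [h']
  exact zero_mem _

variable (F) in
/-- The constant function with value `σ`, as a point of the constant group scheme. -/
def constPt (R : CommAlgCat.{u} F) (σ : H) : (constScheme F H).obj R :=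
  LocallyConstant.const (PrimeSpectrum R) σ

lemma regular_map (a : (constScheme F H ⋙ forget GrpCat.{u}) ⟶ forget (CommAlgCat.{u} F))
    {R S : CommAlgCat.{u} F} (ι : R ⟶ S) (c : (constScheme F H).obj R) :
    (a.app S (((constScheme F H).map ι).hom c) : S) = ι.hom (a.app R c : R) :=
  ConcreteCategory.congr_hom (a.naturality ι) c

/-- A closed subgroup functor through which `f` factors contains the constant functions with
realized value. -/
lemma constPt_mem (f : G ⟶ constScheme F H) {K : SubgroupFunctor (constScheme F H)}
    (hK : K.IsClosed) (hf : ∀ (S : CommAlgCat.{u} F) (g : G.obj S), (f.app S).hom g ∈ K.pts S)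
    {σ : H} (hσ : σ ∈ realized f) (R : CommAlgCat.{u} F) : constPt F R σ ∈ K.pts R := by
  obtain ⟨S, hS, g, hg⟩ := hσ
  -- it suffices to treat `R = F`, where regular functions may be tested after extension to `S`
  suffices h : constPt F (CommAlgCat.of F F) σ ∈ K.pts (CommAlgCat.of F F) from
    K.map_mem (CommAlgCat.ofHom (Algebra.ofId F R)) _ h
  refine hK _ _ fun a ha => ?_
  let i : CommAlgCat.of F F ⟶ S := CommAlgCat.ofHom (Algebra.ofId F S)
  have h1 : ((constScheme F H).map i).hom (constPt F (CommAlgCat.of F F) σ) =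
      (f.app S).hom g := const_ext fun p => (hg p).symm
  have h2 := regular_map a i (constPt F (CommAlgCat.of F F) σ)
  rw [h1, show (a.app S ((f.app S).hom g) : S) = 0 from ha S _ (hf S g)] at h2
  exact (map_eq_zero_iff (algebraMap F S) (algebraMap F S).injective).1 h2.symm

/-- The image of a morphism to a constant group scheme is the constant subgroup scheme of the
realized values. -/
lemma mem_image_iff (f : G ⟶ constScheme F H) {R : CommAlgCat.{u} F}
    {c : (constScheme F H).obj R} :
    c ∈ (SubgroupFunctor.image f).pts R ↔ ∀ p, valueAt c p ∈ realized f := by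
  constructor
  · intro hc
    exact (Subgroup.mem_sInf.1 hc) ((constSub (realized f)).pts R)
      ⟨_, isClosed_constSub _, fun S g p => valueAt_mem_realized f g p, rfl⟩
  · intro hc
    refine Subgroup.mem_sInf.2 ?_
    rintro _ ⟨K, hK, hf, rfl⟩
    refine hK _ _ fun a ha => ?_
    -- the annihilator of the value of `a` at `c` is contained in no prime ideal, since `c` is
    -- constant on a basic neighbourhood of every prime
    by_contra hne
    let z : R := a.app R c
    have hne' : Ideal.span {z} ≠ ⊥ := fun h => hne (Ideal.span_singleton_eq_bot.1 h)
    have hann : Module.annihilator R (Ideal.span {z}) ≠ ⊤ := by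
      intro h
      apply hne
      have := (Module.mem_annihilator.1 (show (1 : R) ∈ Module.annihilator R (Ideal.span {z}) by
        rw [h]; trivial)) ⟨z, Ideal.mem_span_singleton_self z⟩
      rw [one_smul] at this
      exact congrArg Subtype.val this
    obtain ⟨m, hm, hle⟩ := Ideal.exists_le_maximal _ hann
    let p : PrimeSpectrum R := ⟨m, hm.isPrime⟩
    let e : R := fiberIdem c (valueAt c p)
    let i : R ⟶ CommAlgCat.of F (Localization.Away e) :=
      CommAlgCat.ofHom (IsScalarTower.toAlgHom F R _)
    have h1 : ((constScheme F H).map i).hom c = constPt F _ (valueAt c p) := by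
      refine const_ext fun q => ?_
      rw [valueAt_map]
      refine (fiberIdem_notMem c _ _).1 fun hq => ?_
      have hu : IsUnit (i.hom e) := IsLocalization.Away.algebraMap_isUnit e
      exact q.isPrime.ne_top (Ideal.eq_top_of_isUnit_mem _ hq hu)
    have h2 := regular_map a i c
    have h3 := ha _ _ (constPt_mem f hK hf (hc p) (CommAlgCat.of F (Localization.Away e)))
    rw [h1] at h2
    have h4 : algebraMap R (Localization.Away e) z = 0 := h2.symm.trans h3
    obtain ⟨⟨_, n, rfl⟩, hn⟩ := (IsLocalization.map_eq_zero_iff (Submonoid.powers e) _ _).1 h4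
    have hmem : e ^ n ∈ Module.annihilator R (Ideal.span {z}) := by
      rw [Module.mem_annihilator]
      rintro ⟨y, hy⟩
      obtain ⟨t, rfl⟩ := Ideal.mem_span_singleton'.1 hy
      apply Subtype.ext
      change e ^ n * (t * z) = 0
      rw [mul_left_comm, show e ^ n * z = 0 from hn, mul_zero]
    exact (fiberIdem_notMem c (valueAt c p) p).2 rfl (hm.isPrime.mem_of_pow_mem n (hle hmem))

end Const

section Iso

variable {G G' : GroupFunctor F}

/-- An isomorphism of group functors restricts to corresponding subgroup functors. -/
lemma exists_restrict_iso (φ : G ≅ G') (K : SubgroupFunctor G) (K' : SubgroupFunctor G')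
    (h : ∀ (R : CommAlgCat.{u} F) (x : G.obj R),
      (φ.hom.app R).hom x ∈ K'.pts R ↔ x ∈ K.pts R) :
    ∃ ψ : K.toFunctor ≅ K'.toFunctor, ψ.hom ≫ K'.incl = K.incl ≫ φ.hom := by
  have h' : ∀ (R : CommAlgCat.{u} F) (y : G'.obj R), y ∈ K'.pts R →
      (φ.inv.app R).hom y ∈ K.pts R := fun R y hy => by
    rw [← h, show (φ.hom.app R).hom ((φ.inv.app R).hom y) = y from
      ConcreteCategory.congr_hom (φ.inv_hom_id_app R) y]
    exact hy
  refine ⟨⟨{ app R := GrpCat.ofHom (((φ.hom.app R).hom.comp (K.pts R).subtype).codRestrict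
                (K'.pts R) fun x => (h R x.1).2 x.2)
             naturality R S f := ?_ },
           { app R := GrpCat.ofHom (((φ.inv.app R).hom.comp (K'.pts R).subtype).codRestrict
                (K.pts R) fun x => h' R x.1 x.2)
             naturality R S f := ?_ }, ?_, ?_⟩, ?_⟩
  · ext x
    exact Subtype.ext (ConcreteCategory.congr_hom (φ.hom.naturality f) x.1)
  · ext x
    exact Subtype.ext (ConcreteCategory.congr_hom (φ.inv.naturality f) x.1)
  · ext R x
    exact Subtype.ext (ConcreteCategory.congr_hom (φ.hom_inv_id_app R) x.1)
  · ext R x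
    exact Subtype.ext (ConcreteCategory.congr_hom (φ.inv_hom_id_app R) x.1)
  · ext R x
    rfl

variable {H H' : Type u} [Group H] [Group H']

/-- The morphism to the product of two constant group schemes with the given components. -/
def constPair (f : G ⟶ constScheme F H) (f' : G ⟶ constScheme F H') :
    G ⟶ constScheme F (H × H') where
  app R := GrpCat.ofHom (MonoidHom.mk' (G := LocallyConstant (PrimeSpectrum R) (H × H'))
    (fun g => ⟨fun p => (valueAt ((f.app R).hom g) p, valueAt ((f'.app R).hom g) p),
      (LocallyConstant.isLocallyConstant (X := PrimeSpectrum R) (Y := H) _).prodMk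
        (LocallyConstant.isLocallyConstant (X := PrimeSpectrum R) (Y := H') _)⟩)
    fun g k => LocallyConstant.ext fun p => by
      refine Prod.ext ?_ ?_
      · exact congrArg (valueAt · p) (map_mul (f.app R).hom g k)
      · exact congrArg (valueAt · p) (map_mul (f'.app R).hom g k))
  naturality R S ι := by
    ext g
    refine const_ext fun p => Prod.ext ?_ ?_
    · exact valueAt_app_map f ι g p
    · exact valueAt_app_map f' ι g p

lemma valueAt_constPair (f : G ⟶ constScheme F H) (f' : G ⟶ constScheme F H')
    {R : CommAlgCat.{u} F} (g : G.obj R) (p : PrimeSpectrum R) :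
    valueAt (((constPair f f').app R).hom g) p =
      (valueAt ((f.app R).hom g) p, valueAt ((f'.app R).hom g) p) := rfl

lemma mem_realized_constPair_iff {f : G ⟶ constScheme F H} {f' : G ⟶ constScheme F H'}
    {q : H × H'} : q ∈ realized (constPair f f') ↔
      ∃ S : CommAlgCat.{u} F, Nontrivial S ∧ ∃ g : G.obj S,
        (∀ p, valueAt ((f.app S).hom g) p = q.1) ∧ ∀ p, valueAt ((f'.app S).hom g) p = q.2 := by
  refine exists_congr fun S => and_congr_right fun _ => exists_congr fun g => ?_
  simp only [valueAt_constPair, Prod.ext_iff, forall_and]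

/-- Two morphisms to constant group schemes that have the same kernel have isomorphic groups of
realized values, compatibly with the morphisms. -/
lemma exists_realized_equiv (ψ : G ≅ G') (f : G ⟶ constScheme F H) (f' : G' ⟶ constScheme F H')
    (h : ∀ (R : CommAlgCat.{u} F) (x : G.obj R),
      (f.app R).hom x = 1 ↔ (f'.app R).hom ((ψ.hom.app R).hom x) = 1) :
    ∃ θ : realized f ≃* realized f', ∀ (R : CommAlgCat.{u} F) (x : G.obj R) (p : PrimeSpectrum R),
      (θ ⟨_, valueAt_mem_realized f x p⟩ : H') =
        valueAt ((f'.app R).hom ((ψ.hom.app R).hom x)) p := by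
  -- the graph of the isomorphism: its projections are injective because the kernels agree
  let P := realized (constPair f (ψ.hom ≫ f'))
  have hP : ∀ (R : CommAlgCat.{u} F) (x : G.obj R) (p : PrimeSpectrum R),
      (valueAt ((f.app R).hom x) p, valueAt ((f'.app R).hom ((ψ.hom.app R).hom x)) p) ∈ P :=
    fun R x p => valueAt_mem_realized (constPair f (ψ.hom ≫ f')) x p
  let π₁ : P →* realized f := ((MonoidHom.fst H H').comp P.subtype).codRestrict _ (by
    rintro ⟨q, hq⟩
    obtain ⟨S, hS, g, h1, -⟩ := mem_realized_constPair_iff.1 hq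
    exact ⟨S, hS, g, h1⟩)
  let π₂ : P →* realized f' := ((MonoidHom.snd H H').comp P.subtype).codRestrict _ (by
    rintro ⟨q, hq⟩
    obtain ⟨S, hS, g, -, h2⟩ := mem_realized_constPair_iff.1 hq
    exact ⟨S, hS, _, h2⟩)
  have b₁ : Function.Bijective π₁ := by
    constructor
    · rw [injective_iff_map_eq_one]
      rintro ⟨⟨σ, σ'⟩, hq⟩ h1
      obtain rfl : σ = 1 := congrArg Subtype.val h1
      obtain ⟨S, hS, g, hg, hg'⟩ := mem_realized_constPair_iff.1 hq
      have h2 := (h S g).1 (const_ext hg)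
      obtain ⟨p⟩ : Nonempty (PrimeSpectrum S) := inferInstance
      refine Subtype.ext (Prod.ext rfl ?_)
      refine (hg' p).symm.trans ?_
      exact congrArg (valueAt · p) h2
    · rintro ⟨σ, S, hS, g, hg⟩
      obtain ⟨p⟩ : Nonempty (PrimeSpectrum S) := inferInstance
      exact ⟨⟨_, hP S g p⟩, Subtype.ext (hg p)⟩
  have b₂ : Function.Bijective π₂ := by
    constructor
    · rw [injective_iff_map_eq_one]
      rintro ⟨⟨σ, σ'⟩, hq⟩ h1
      obtain rfl : σ' = 1 := congrArg Subtype.val h1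
      obtain ⟨S, hS, g, hg, hg'⟩ := mem_realized_constPair_iff.1 hq
      have h2 := (h S g).2 (const_ext hg')
      obtain ⟨p⟩ : Nonempty (PrimeSpectrum S) := inferInstance
      refine Subtype.ext (Prod.ext ?_ rfl)
      refine (hg p).symm.trans ?_
      exact congrArg (valueAt · p) h2
    · rintro ⟨σ, S, hS, g', hg⟩
      obtain ⟨p⟩ : Nonempty (PrimeSpectrum S) := inferInstance
      refine ⟨⟨_, hP S ((ψ.inv.app S).hom g') p⟩, Subtype.ext ?_⟩
      refine Eq.trans ?_ (hg p)
      have e := ConcreteCategory.congr_hom (ψ.inv_hom_id_app S) g'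
      exact congrArg (fun y => valueAt ((f'.app S).hom y) p) e
  let e₁ := MulEquiv.ofBijective π₁ b₁
  let e₂ := MulEquiv.ofBijective π₂ b₂
  refine ⟨e₁.symm.trans e₂, fun R x p => ?_⟩
  have : e₁.symm ⟨_, valueAt_mem_realized f x p⟩ = ⟨_, hP R x p⟩ :=
    (MulEquiv.symm_apply_eq _).2 rfl
  rw [MulEquiv.trans_apply, this]
  rfl

/-- A homomorphism between subgroups of `H` and `H'`, applied to the values of locally constant
functions, as a morphism between the subgroup functors of functions with values in these
subgroups. -/
def mapValues {N : Subgroup H} {N' : Subgroup H'} (θ : N →* N')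
    (K : SubgroupFunctor (constScheme F H)) (K' : SubgroupFunctor (constScheme F H'))
    (hK : ∀ (R : CommAlgCat.{u} F) (c : (constScheme F H).obj R),
      c ∈ K.pts R → ∀ p, valueAt c p ∈ N)
    (hK' : ∀ (R : CommAlgCat.{u} F) (c : (constScheme F H').obj R),
      (∀ p, valueAt c p ∈ N') → c ∈ K'.pts R) : K.toFunctor ⟶ K'.toFunctor where
  app R := GrpCat.ofHom (MonoidHom.mk' (M := K.pts R) (G := K'.pts R)
    (fun c => ⟨(⟨fun p => (θ ⟨valueAt c.1 p, hK R c.1 c.2 p⟩ : H'), by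
      rw [IsLocallyConstant.iff_exists_open]
      intro p
      obtain ⟨V, hV, hp, hc⟩ := (IsLocallyConstant.iff_exists_open _).1
        (LocallyConstant.isLocallyConstant (X := PrimeSpectrum R) (Y := H) c.1) p
      refine ⟨V, hV, hp, fun q hq => ?_⟩
      have : valueAt c.1 q = valueAt c.1 p := hc q hq
      simp only [this]⟩ : LocallyConstant (PrimeSpectrum R) H'),
      hK' R _ fun p => (θ _).2⟩)
    fun c d => Subtype.ext (const_ext fun p =>
      congrArg Subtype.val (θ.map_mul ⟨valueAt c.1 p, hK R c.1 c.2 p⟩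
        ⟨valueAt d.1 p, hK R d.1 d.2 p⟩)))
  naturality R S ι := by
    ext c
    rfl

/-- Morphisms to constant group schemes with the same kernel have isomorphic images. -/
lemma exists_image_iso (ψ : G ≅ G') (f : G ⟶ constScheme F H) (f' : G' ⟶ constScheme F H')
    (h : ∀ (R : CommAlgCat.{u} F) (x : G.obj R),
      (f.app R).hom x = 1 ↔ (f'.app R).hom ((ψ.hom.app R).hom x) = 1) :
    ∃ ω : (SubgroupFunctor.image f).toFunctor ≅ (SubgroupFunctor.image f').toFunctor,
      SubgroupFunctor.toImage f ≫ ω.hom = ψ.hom ≫ SubgroupFunctor.toImage f' := by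
  obtain ⟨θ, hθ⟩ := exists_realized_equiv ψ f f' h
  refine ⟨⟨mapValues θ.toMonoidHom _ _ (fun R c => (mem_image_iff f).1)
      fun R c => (mem_image_iff f').2,
    mapValues θ.symm.toMonoidHom _ _ (fun R c => (mem_image_iff f').1)
      fun R c => (mem_image_iff f).2, ?_, ?_⟩, ?_⟩
  · ext R c
    refine Subtype.ext (const_ext fun p => ?_)
    exact congrArg Subtype.val (θ.symm_apply_apply ⟨valueAt c.1 p, (mem_image_iff f).1 c.2 p⟩)
  · ext R c
    refine Subtype.ext (const_ext fun p => ?_)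
    exact congrArg Subtype.val (θ.apply_symm_apply ⟨valueAt c.1 p, (mem_image_iff f').1 c.2 p⟩)
  · ext R x
    exact Subtype.ext (const_ext fun p => hθ R x p)

end Iso

/-- Membership in a submodule may be checked locally on the spectrum. -/
lemma mem_of_locally_mem {R : Type*} [CommRing R] {M : Type*} [AddCommGroup M] [Module R M]
    (N : Submodule R M) (x : M)
    (h : ∀ p : PrimeSpectrum R, ∃ e ∉ p.asIdeal, e • x ∈ N) : x ∈ N := by
  let I : Ideal R := N.comap (LinearMap.toSpanSingleton R M x)
  have hI : I = ⊤ := by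
    by_contra hne
    obtain ⟨m, hm, hle⟩ := Ideal.exists_le_maximal _ hne
    obtain ⟨e, he, hx⟩ := h ⟨m, hm.isPrime⟩
    exact he (hle hx)
  have h1 : (1 : R) ∈ I := hI ▸ Submodule.mem_top
  simpa [I] using h1

namespace Grading

variable {U : Type u} [CommGroup U] {A : Type u} [NonUnitalNonAssocRing A] [Module F A]
  [IsScalarTower F A A] [SMulCommClass F A A] (Γ : Grading F U A)

/-- The kernel of `Aut(Γ) → Sym(Supp Γ)` is `Stab(Γ)`. -/
lemma toSym_eq_one_iff {R : CommAlgCat.{u} F} (x : Γ.aut.toFunctor.obj R) :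
    (Γ.toSym.app R).hom x = 1 ↔ x.1 ∈ Γ.stab.pts R := by
  constructor
  · intro h g
    by_cases hg : Γ.comp g = ⊥
    · rw [hg, Submodule.baseChange_bot, Submodule.map_bot]
    have hp : ∀ p : PrimeSpectrum R, ∃ e ∉ p.asIdeal,
        (block R (Γ.comp g) e).map (autEnd x.1) = block R (Γ.comp g) e := by
      intro p
      obtain ⟨e, he, hσ⟩ := Γ.permOf_spec (autEnd x.1) x.2 p
      have h1 : Γ.permOf (autEnd x.1) x.2 p = 1 := congrArg (valueAt · p) h
      rw [h1] at hσ
      exact ⟨e, he, hσ ⟨g, hg⟩⟩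
    apply le_antisymm
    · rintro _ ⟨y, hy, rfl⟩
      refine mem_of_locally_mem _ _ fun p => ?_
      obtain ⟨e, he, hmap⟩ := hp p
      refine ⟨e, he, block_le _ e ?_⟩
      rw [← hmap, ← map_smul]
      exact ⟨_, ⟨y, hy, rfl⟩, rfl⟩
    · intro y hy
      refine mem_of_locally_mem _ _ fun p => ?_
      obtain ⟨e, he, hmap⟩ := hp p
      refine ⟨e, he, Submodule.map_mono (block_le _ e) ?_⟩
      rw [hmap]
      exact ⟨y, hy, rfl⟩
  · intro h
    refine const_ext fun p => ?_
    refine (Γ.permOf_spec (autEnd x.1) x.2 p).unique ⟨1, p.isPrime.one_notMem, fun s => ?_⟩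
    rw [block_one, block_one]
    exact h s.1

end Grading
end
end GradingScheme

/-! ### Transport along an isomorphism of automorphism group schemes -/

open GradingScheme in
theorem corollary3p4 {F : Type u} [Field F]
    {A : Type u} [NonUnitalNonAssocRing A] [Module F A] [IsScalarTower F A A]
    [SMulCommClass F A A] [FiniteDimensional F A]
    {B : Type u} [NonUnitalNonAssocRing B] [Module F B] [IsScalarTower F B B]
    [SMulCommClass F B B] [FiniteDimensional F B]
    (φ : autScheme F A ≅ autScheme F B)
    {U : Type u} [CommGroup U] (Γ : Grading F U A)
    (hfine : Γ.IsFine) (huniv : Γ.IsUniversal) :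
    ∃ Γ' : Grading F U B,
      -- `Γ'` is the grading by `U` on `B` associated with `φ ∘ η_Γ`
      (Γ'.eta = Γ.eta ≫ φ.hom ∧ ∀ Δ : Grading F U B, Δ.eta = Γ.eta ≫ φ.hom → Δ = Γ') ∧
      Γ'.IsFine ∧
      -- `φ` restricts to an isomorphism of stabilizers
      (∃ ψ : Γ.stab.toFunctor ≅ Γ'.stab.toFunctor,
        ψ.hom ≫ Γ'.stab.incl = Γ.stab.incl ≫ φ.hom) ∧
      -- `φ` restricts to an isomorphism of automorphism group schemes of the gradings,
      -- and this induces an isomorphism of Weyl group schemes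
      (∃ ψ : Γ.aut.toFunctor ≅ Γ'.aut.toFunctor,
        ψ.hom ≫ Γ'.aut.incl = Γ.aut.incl ≫ φ.hom ∧
        ∃ ω : Γ.weyl.toFunctor ≅ Γ'.weyl.toFunctor,
          Γ.toWeyl ≫ ω.hom = ψ.hom ≫ Γ'.toWeyl) := by
  have hd := huniv.diagLeEta
  obtain ⟨Γ', hη⟩ : ∃ Γ' : Grading F U B, Γ'.eta = Γ.eta ≫ φ.hom :=
    ⟨Grading.ofHom (Γ.eta ≫ φ.hom), Grading.eta_ofHom _⟩
  have hd' : Γ'.DiagLeEta := hd.transport hfine hη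
  have hstab : ∀ (R : CommAlgCat.{u} F) (x : (autScheme F A).obj R),
      (φ.hom.app R).hom x ∈ Γ'.stab.pts R ↔ x ∈ Γ.stab.pts R := fun R x => by
    rw [Γ'.mem_stab_iff, Γ.mem_stab_iff, hη, centralizes_map_iff]
  have haut : ∀ (R : CommAlgCat.{u} F) (x : (autScheme F A).obj R),
      (φ.hom.app R).hom x ∈ Γ'.aut.pts R ↔ x ∈ Γ.aut.pts R := fun R x => by
    rw [Γ'.mem_aut_iff hd', Γ.mem_aut_iff hd, hη, normalizes_map_iff]
  obtain ⟨ψ, hψ⟩ := exists_restrict_iso φ Γ.aut Γ'.aut haut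
  refine ⟨Γ', ⟨hη, fun Δ hΔ => Grading.eta_injective (hΔ.trans hη.symm)⟩,
    hfine.transport hd hη, exists_restrict_iso φ _ _ hstab, ψ, hψ,
    exists_image_iso ψ Γ.toSym Γ'.toSym fun R x => ?_⟩
  have h : ((ψ.hom.app R).hom x).1 = (φ.hom.app R).hom x.1 :=
    ConcreteCategory.congr_hom (NatTrans.congr_app hψ R) x
  rw [Γ.toSym_eq_one_iff, Γ'.toSym_eq_one_iff, h, hstab]
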